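/- Let $k$ be a field and let $K=k(\xi_1,\xi_2,\ldots)$ be the rational function field in infinitely many variables. Let $\mathfrak S=\bigcup_{n\ge 1}\mathfrak S_n$ be the infinite symmetric group, acting on $K$ by $k$-automorphisms permuting the variables, and let $\mathfrak S^n\subset\mathfrak S$ be the subgroup fixing each of $1,\ldots,n$. Let $\mathcal A$ be the category of smooth $K$-semilinear representations of $\mathfrak S$: its objects are the $K$-vector spaces $M$ with an additive action of $\mathfrak S$ such that $\sigma(ax)=(\sigma a)(\sigma x)$ for all $\sigma\in\mathfrak S$, $a\in K$, $x\in M$, and such that every $x\in M$ is fixed by $\mathfrak S^n$ for some $n$; its morphisms are the $\mathfrak S$-equivariant $K$-linear maps. For $r\ge 0$ let $\mathbf V^r$ be the $k$-vector space with basis $\{e_S\}$, where $S$ runs over the $r$-element subsets of $\{1,2,\ldots\}$ and $\sigma e_S=e_{\sigma S}$ for $\sigma\in\mathfrak S$, and let $\mathbf I^r=K\otimes_k\mathbf V^r$, with $\sigma(a\otimes v)=\sigma a\otimes\sigma v$; it is an object of $\mathcal A$. An object of $\mathcal A$ is called standard if it is isomorphic to a (possibly infinite or empty) direct sum of objects of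 the form $\mathbf I^r$, $r\ge 0$. (a) Every injective object of $\mathcal A$ is standard. (b) The indecomposable injective objects of $\mathcal A$ are, up to isomorphism, exactly the $\mathbf I^r$: an object $M$ of $\mathcal A$ is injective and indecomposable (that is, non-zero and not isomorphic to a direct sum of two non-zero objects) if and only if $M\cong\mathbf I^r$ for some $r\ge 0$. -/

import Mathlib

universe u

open CategoryTheory

noncomputable section

namespace SemilinRep

/-! ### The infinite symmetric group -/

/-- The infinite symmetric group `𝔖 = ⋃ₙ 𝔖ₙ`: the permutations of the letters `0, 1, 2, …`
(the letter `i` plays the role of `i + 1 ∈ {1, 2, …}`) that fix all but finitely many letters. -/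
def infSymm : Subgroup (Equiv.Perm ℕ) where
  carrier := {σ | ∃ n, ∀ i, n ≤ i → σ i = i}
  one_mem' := ⟨0, fun _ _ => rfl⟩
  mul_mem' := by
    rintro σ τ ⟨m, hm⟩ ⟨n, hn⟩
    refine ⟨max m n, fun i hi => ?_⟩
    rw [Equiv.Perm.mul_apply, hn i (le_trans (le_max_right _ _) hi),
      hm i (le_trans (le_max_left _ _) hi)]
  inv_mem' := by
    rintro σ ⟨m, hm⟩
    refine ⟨m, fun i hi => ?_⟩
    rw [Equiv.Perm.inv_eq_iff_eq, hm i hi]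

/-- The subgroup `𝔖ⁿ` of `𝔖` of the permutations that fix each of the first `n` letters. -/
def fixFirst (n : ℕ) : Subgroup infSymm where
  carrier := {σ | ∀ i, i < n → (σ : Equiv.Perm ℕ) i = i}
  one_mem' := fun _ _ => rfl
  mul_mem' := by
    intro σ τ hσ hτ i hi
    rw [Subgroup.coe_mul, Equiv.Perm.mul_apply, hτ i hi, hσ i hi]
  inv_mem' := by
    intro σ hσ i hi
    rw [Subgroup.coe_inv, Equiv.Perm.inv_eq_iff_eq, hσ i hi]

theorem fixFirst_anti {m n : ℕ} (h : m ≤ n) : fixFirst n ≤ fixFirst m :=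
  fun _ hσ i hi => hσ i (lt_of_lt_of_le hi h)

/-- An action of `𝔖` on a set is smooth if each element is stabilized by some `𝔖ⁿ`. -/
def IsSmooth (X : Type*) [SMul infSymm X] : Prop :=
  ∀ x : X, ∃ n : ℕ, ∀ σ ∈ fixFirst n, σ • x = x

/-! ### The field of rational functions in infinitely many variables -/

variable (k : Type u) [Field k]

/-- The rational function field `𝐊 = k(ξ₁, ξ₂, …)`. -/
def RatFun : Type u := FractionRing (MvPolynomial ℕ k)

instance : Field (RatFun k) := inferInstanceAs (Field (FractionRing (MvPolynomial ℕ k)))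

instance : Algebra (MvPolynomial ℕ k) (RatFun k) :=
  inferInstanceAs (Algebra (MvPolynomial ℕ k) (FractionRing (MvPolynomial ℕ k)))

instance : IsFractionRing (MvPolynomial ℕ k) (RatFun k) :=
  inferInstanceAs (IsFractionRing (MvPolynomial ℕ k) (FractionRing (MvPolynomial ℕ k)))

instance : Algebra k (RatFun k) :=
  inferInstanceAs (Algebra k (FractionRing (MvPolynomial ℕ k)))

instance : IsScalarTower k (MvPolynomial ℕ k) (RatFun k) :=
  inferInstanceAs (IsScalarTower k (MvPolynomial ℕ k) (FractionRing (MvPolynomial ℕ k)))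

/-- `𝔖` acts on `k[ξ₁, ξ₂, …]` by `k`-algebra automorphisms permuting the variables. -/
def polyAct : infSymm →* (MvPolynomial ℕ k ≃ₐ[k] MvPolynomial ℕ k) where
  toFun σ := MvPolynomial.renameEquiv k (σ : Equiv.Perm ℕ)
  map_one' := MvPolynomial.renameEquiv_refl k
  map_mul' σ τ := (MvPolynomial.renameEquiv_trans k (τ : Equiv.Perm ℕ) (σ : Equiv.Perm ℕ)).symm

/-- The induced action of `𝔖` on `𝐊` by `k`-automorphisms. -/
def ratAct : infSymm →* (RatFun k ≃ₐ[k] RatFun k) :=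
  (IsFractionRing.fieldEquivOfAlgEquivHom k (RatFun k)).comp (polyAct k)

instance : MulSemiringAction infSymm (RatFun k) :=
  MulSemiringAction.compHom (RatFun k) (ratAct k)

variable {k} in
theorem smul_ratFun_def (σ : infSymm) (a : RatFun k) : σ • a = ratAct k σ a := rfl

theorem smul_algebraMap (σ : infSymm) (p : MvPolynomial ℕ k) :
    σ • algebraMap (MvPolynomial ℕ k) (RatFun k) p =
      algebraMap (MvPolynomial ℕ k) (RatFun k)
        (MvPolynomial.rename (σ : Equiv.Perm ℕ) p) := by
  simp [smul_ratFun_def, ratAct, polyAct]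

theorem isSmooth_ratFun : IsSmooth (RatFun k) := by
  have key : ∀ p : MvPolynomial ℕ k, ∃ n : ℕ, ∀ σ ∈ fixFirst n,
      MvPolynomial.rename ((σ : Equiv.Perm ℕ) : ℕ → ℕ) p = p := by
    intro p
    refine ⟨p.vars.sup id + 1, fun σ hσ => ?_⟩
    have : MvPolynomial.rename ((σ : Equiv.Perm ℕ) : ℕ → ℕ) p = MvPolynomial.rename id p := by
      refine MvPolynomial.hom_congr_vars (f₁ := (MvPolynomial.rename ((σ : Equiv.Perm ℕ) : ℕ → ℕ) :
        MvPolynomial ℕ k →ₐ[k] MvPolynomial ℕ k).toRingHom)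
        (f₂ := (MvPolynomial.rename id : MvPolynomial ℕ k →ₐ[k] MvPolynomial ℕ k).toRingHom)
        (by ext; simp) (fun i hi _ => ?_) rfl
      have : i ≤ p.vars.sup id := Finset.le_sup (f := id) hi
      simp [hσ i (by omega)]
    rw [this, MvPolynomial.rename_id_apply]
  intro x
  obtain ⟨a, b, -, rfl⟩ := IsFractionRing.div_surjective (MvPolynomial ℕ k) x
  obtain ⟨m, hm⟩ := key a
  obtain ⟨n, hn⟩ := key b
  refine ⟨max m n, fun σ hσ => ?_⟩
  rw [smul_div₀', smul_algebraMap, smul_algebraMap, hm σ (fixFirst_anti (le_max_left _ _) hσ),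
    hn σ (fixFirst_anti (le_max_right _ _) hσ)]

end SemilinRep

/-! ### The category of smooth semilinear representations -/

/-- A smooth `𝐊`-semilinear representation of `𝔖`: a `𝐊`-vector space `V` with an additive
action of `𝔖` such that `σ (a v) = (σ a) (σ v)` and such that each vector is stabilized by
some `𝔖ⁿ`. -/
structure SmoothSemilinRep (k : Type u) [Field k] : Type (u + 1) where
  carrier : Type u
  [addCommGroup : AddCommGroup carrier]
  [module : Module (SemilinRep.RatFun k) carrier]
  [action : DistribMulAction SemilinRep.infSymm carrier]
  semilinear : ∀ (σ : SemilinRep.infSymm) (a : SemilinRep.RatFun k) (v : carrier),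
    σ • (a • v) = (σ • a) • (σ • v)
  smooth : SemilinRep.IsSmooth carrier

namespace SmoothSemilinRep

open SemilinRep

variable {k : Type u} [Field k]

instance : CoeSort (SmoothSemilinRep k) (Type u) := ⟨carrier⟩

attribute [instance] addCommGroup module action

/-- A morphism of semilinear representations: a `𝐊`-linear map that commutes with `𝔖`. -/
@[ext]
structure Hom (M N : SmoothSemilinRep k) : Type u where
  toLinearMap : M →ₗ[RatFun k] N
  map_smul' : ∀ (σ : infSymm) (x : M), toLinearMap (σ • x) = σ • toLinearMap x

instance : Category (SmoothSemilinRep k) where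
  Hom := Hom
  id M := ⟨LinearMap.id, fun _ _ => rfl⟩
  comp f g := ⟨g.toLinearMap ∘ₗ f.toLinearMap, fun σ x => by
    simp [f.map_smul', g.map_smul']⟩

/-- The `𝐊`-linear map underlying a morphism. -/
def lin {M N : SmoothSemilinRep k} (f : M ⟶ N) : M →ₗ[RatFun k] N := Hom.toLinearMap f

/-- The morphism given by an equivariant `𝐊`-linear map. -/
def ofLin {M N : SmoothSemilinRep k} (f : M →ₗ[RatFun k] N)
    (h : ∀ (σ : infSymm) (x : M), f (σ • x) = σ • f x) : M ⟶ N := Hom.mk f h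

theorem lin_smul {M N : SmoothSemilinRep k} (f : M ⟶ N) (σ : infSymm) (x : M) :
    lin f (σ • x) = σ • lin f x := Hom.map_smul' f σ x

theorem lin_injective {M N : SmoothSemilinRep k} :
    Function.Injective (lin : (M ⟶ N) → (M →ₗ[RatFun k] N)) :=
  fun _ _ h => Hom.ext h

@[ext]
theorem hom_ext {M N : SmoothSemilinRep k} {f g : M ⟶ N} (h : ∀ x, lin f x = lin g x) : f = g :=
  lin_injective (LinearMap.ext h)

@[simp]
theorem lin_ofLin {M N : SmoothSemilinRep k} (f : M →ₗ[RatFun k] N)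
    (h : ∀ (σ : infSymm) (x : M), f (σ • x) = σ • f x) : lin (ofLin f h) = f := rfl

@[simp]
theorem lin_id (M : SmoothSemilinRep k) : lin (𝟙 M) = LinearMap.id := rfl

@[simp]
theorem lin_comp {M N P : SmoothSemilinRep k} (f : M ⟶ N) (g : N ⟶ P) :
    lin (f ≫ g) = lin g ∘ₗ lin f := rfl

/-! Morphisms are added pointwise. -/

section Additive

variable {M N : SmoothSemilinRep k}

instance : Zero (M ⟶ N) := ⟨ofLin 0 fun σ x => by simp⟩
instance : Add (M ⟶ N) := ⟨fun f g => ofLin (lin f + lin g) fun σ x => by simp [lin_smul]⟩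
instance : Neg (M ⟶ N) := ⟨fun f => ofLin (-lin f) fun σ x => by simp [lin_smul]⟩
instance : Sub (M ⟶ N) := ⟨fun f g => ofLin (lin f - lin g) fun σ x => by
  simp [lin_smul, smul_sub]⟩
instance : SMul ℕ (M ⟶ N) := ⟨fun n f => ofLin (n • lin f) fun σ x => by
  simp [lin_smul, smul_comm σ n]⟩
instance : SMul ℤ (M ⟶ N) := ⟨fun n f => ofLin (n • lin f) fun σ x => by
  simp [lin_smul, smul_comm σ n]⟩

instance : AddCommGroup (M ⟶ N) :=
  Function.Injective.addCommGroup lin lin_injective rfl (fun _ _ => rfl) (fun _ => rfl)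
    (fun _ _ => rfl) (fun _ _ => rfl) (fun _ _ => rfl)

@[simp] theorem lin_zero : lin (0 : M ⟶ N) = 0 := rfl
@[simp] theorem lin_add (f g : M ⟶ N) : lin (f + g) = lin f + lin g := rfl

end Additive

instance : Preadditive (SmoothSemilinRep k) where
  add_comp _ _ _ f f' g := by ext x; simp
  comp_add _ _ _ f g g' := by ext x; simp

/-- The direct sum of two objects; it is used only to see that binary biproducts exist. -/
def prod (M N : SmoothSemilinRep k) : SmoothSemilinRep k where
  carrier := M × N
  semilinear σ a v := Prod.ext (M.semilinear σ a v.1) (N.semilinear σ a v.2)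
  smooth v := by
    obtain ⟨m, hm⟩ := M.smooth v.1
    obtain ⟨n, hn⟩ := N.smooth v.2
    exact ⟨max m n, fun σ hσ => Prod.ext (hm σ (fixFirst_anti (le_max_left _ _) hσ))
      (hn σ (fixFirst_anti (le_max_right _ _) hσ))⟩

/-- The biproduct structure on `prod M N`. -/
def prodBicone (M N : SmoothSemilinRep k) : Limits.BinaryBicone M N where
  pt := prod M N
  fst := ofLin (M := prod M N) (LinearMap.fst (RatFun k) M N) fun _ _ => rfl
  snd := ofLin (M := prod M N) (LinearMap.snd (RatFun k) M N) fun _ _ => rfl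
  inl := ofLin (N := prod M N) (LinearMap.inl (RatFun k) M N) fun σ _ =>
    Prod.ext rfl (smul_zero σ).symm
  inr := ofLin (N := prod M N) (LinearMap.inr (RatFun k) M N) fun σ _ =>
    Prod.ext (smul_zero σ).symm rfl
  inl_fst := rfl
  inl_snd := rfl
  inr_fst := rfl
  inr_snd := rfl

instance : Limits.HasBinaryBiproducts (SmoothSemilinRep k) where
  has_binary_biproduct M N := Limits.HasBinaryBiproduct.mk
    { bicone := prodBicone M N
      isBilimit := Limits.isBinaryBilimitOfTotal _ (hom_ext fun x =>
        Prod.ext (add_zero x.1) (zero_add x.2)) }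

/-- The direct sum `⨁ᵢ Mᵢ` of a family of objects, with the componentwise action. -/
def directSum {ι : Type u} (M : ι → SmoothSemilinRep k) : SmoothSemilinRep k where
  carrier := Π₀ i, M i
  semilinear σ a v := DFinsupp.ext fun i => (M i).semilinear σ a (v i)
  smooth v := by
    classical
    choose n hn using fun i => (M i).smooth (v i)
    refine ⟨v.support.sup n, fun σ hσ => DFinsupp.ext fun i => ?_⟩
    by_cases hi : i ∈ v.support
    · exact hn i σ (fixFirst_anti (Finset.le_sup hi) hσ)
    · rw [DFinsupp.notMem_support_iff] at hi
      rw [DFinsupp.smul_apply, hi, smul_zero]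

/-! ### Standard objects -/

variable (k) in
/-- The `k`-vector space `𝐕^r` with basis `e_S`, for `S` the `r`-element sets of letters. -/
abbrev VSpace (r : ℕ) : Type u := Set.powersetCard ℕ r →₀ k

variable (k) in
/-- The `k`-linear action of `𝔖` on `𝐕^r`, given by `σ e_S = e_{σ S}`. -/
def vAct (r : ℕ) : Representation k infSymm (VSpace k r) where
  toFun σ := Finsupp.lmapDomain k k (fun S : Set.powersetCard ℕ r => σ • S)
  map_one' := by ext; simp
  map_mul' σ τ := by ext; simp [mul_smul]

variable (k) in
/-- The `𝐊`-vector space `𝐊 ⊗ₖ 𝐕^r`. -/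
def ISpace (r : ℕ) : Type u := TensorProduct k (RatFun k) (VSpace k r)

instance (r : ℕ) : AddCommGroup (ISpace k r) :=
  inferInstanceAs (AddCommGroup (TensorProduct k (RatFun k) (VSpace k r)))

instance (r : ℕ) : Module (RatFun k) (ISpace k r) :=
  inferInstanceAs (Module (RatFun k) (TensorProduct k (RatFun k) (VSpace k r)))

/-- The pure tensor `a ⊗ v`. -/
def pureTensor {r : ℕ} (a : RatFun k) (v : VSpace k r) : ISpace k r := TensorProduct.tmul k a v

theorem ISpace.induction {r : ℕ} {p : ISpace k r → Prop} (x : ISpace k r) (zero : p 0)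
    (pure : ∀ a v, p (pureTensor a v)) (add : ∀ x y, p x → p y → p (x + y)) : p x :=
  TensorProduct.induction_on x zero pure add

/-- The diagonal action of `𝔖` on `𝐊 ⊗ₖ 𝐕^r`, that is, `σ (a ⊗ v) = σ a ⊗ σ v`. -/
instance (r : ℕ) : DistribMulAction infSymm (ISpace k r) where
  smul σ := (TensorProduct.map (ratAct k σ).toLinearMap (vAct k r σ) :
    TensorProduct k (RatFun k) (VSpace k r) →ₗ[k] TensorProduct k (RatFun k) (VSpace k r))
  one_smul x := by
    change TensorProduct.map (ratAct k 1).toLinearMap (vAct k r 1) x = x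
    rw [map_one, map_one]
    exact DFunLike.congr_fun TensorProduct.map_id x
  mul_smul σ τ x := by
    change TensorProduct.map (ratAct k (σ * τ)).toLinearMap (vAct k r (σ * τ)) x =
      TensorProduct.map (ratAct k σ).toLinearMap (vAct k r σ)
        (TensorProduct.map (ratAct k τ).toLinearMap (vAct k r τ) x)
    rw [map_mul, map_mul]
    exact DFunLike.congr_fun (TensorProduct.map_comp (ratAct k σ).toLinearMap
      (vAct k r σ) (ratAct k τ).toLinearMap (vAct k r τ)) x
  smul_zero σ := LinearMap.map_zero
    (TensorProduct.map (ratAct k σ).toLinearMap (vAct k r σ))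
  smul_add σ := LinearMap.map_add
    (TensorProduct.map (ratAct k σ).toLinearMap (vAct k r σ))

theorem smul_pureTensor {r : ℕ} (σ : infSymm) (a : RatFun k) (v : VSpace k r) :
    σ • pureTensor a v = pureTensor (σ • a) (vAct k r σ v) := rfl

theorem ratFun_smul_pureTensor {r : ℕ} (b a : RatFun k) (v : VSpace k r) :
    b • pureTensor a v = pureTensor (b * a) v := rfl

theorem vAct_smooth (r : ℕ) (v : VSpace k r) :
    ∃ n : ℕ, ∀ σ ∈ fixFirst n, vAct k r σ v = v := by
  induction v using Finsupp.induction_linear with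
  | zero => exact ⟨0, fun σ _ => map_zero _⟩
  | add f g hf hg =>
    obtain ⟨m, hm⟩ := hf
    obtain ⟨n, hn⟩ := hg
    refine ⟨max m n, fun σ hσ => ?_⟩
    rw [map_add, hm σ (fixFirst_anti (le_max_left _ _) hσ),
      hn σ (fixFirst_anti (le_max_right _ _) hσ)]
  | single S c =>
    refine ⟨(S : Finset ℕ).sup id + 1, fun σ hσ => ?_⟩
    have h : σ • S = S := by
      apply Subtype.ext
      have h1 : ∀ i ∈ (S : Finset ℕ), σ • i = i := fun i hi =>
        hσ i (Nat.lt_succ_of_le (Finset.le_sup (f := id) hi))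
      change Finset.image (fun i => σ • i) (S : Finset ℕ) = S
      rw [Finset.image_congr (g := id) (fun i hi => h1 i hi), Finset.image_id]
    simp [vAct, h]

variable (k) in
/-- The object `𝐈^r = 𝐊 ⊗ₖ 𝐕^r`. -/
def I (r : ℕ) : SmoothSemilinRep k where
  carrier := ISpace k r
  semilinear σ a x := by
    induction x using ISpace.induction with
    | zero => simp
    | pure b v =>
      rw [ratFun_smul_pureTensor, smul_pureTensor, smul_pureTensor, ratFun_smul_pureTensor,
        smul_mul']
    | add x y hx hy => simp [hx, hy]
  smooth x := by
    induction x using ISpace.induction with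
    | zero => exact ⟨0, fun σ _ => smul_zero σ⟩
    | pure b v =>
      obtain ⟨m, hm⟩ := isSmooth_ratFun k b
      obtain ⟨n, hn⟩ := vAct_smooth r v
      refine ⟨max m n, fun σ hσ => ?_⟩
      rw [smul_pureTensor, hm σ (fixFirst_anti (le_max_left _ _) hσ),
        hn σ (fixFirst_anti (le_max_right _ _) hσ)]
    | add x y hx hy =>
      obtain ⟨m, hm⟩ := hx
      obtain ⟨n, hn⟩ := hy
      refine ⟨max m n, fun σ hσ => ?_⟩
      rw [smul_add, hm σ (fixFirst_anti (le_max_left _ _) hσ),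
        hn σ (fixFirst_anti (le_max_right _ _) hσ)]

/-- An object is standard if it is isomorphic to a (possibly infinite or empty) direct sum of
objects of the form `𝐈^r`. -/
def IsStandard (M : SmoothSemilinRep k) : Prop :=
  ∃ (ι : Type u) (r : ι → ℕ), Nonempty (M ≅ directSum fun i => I k (r i))

end SmoothSemilinRep

end

/-! Two facts carry the theorem: sums of the `𝐈^r` are injective, and every non-zero object contains
a non-zero subobject that embeds in some `𝐈^r`.

Injectivity. A vector is supported by a finite set `S` if the permutations fixing `S` pointwise fix
it. By Galois descent (`mem_span_stabilized`), a cyclic object is spanned by finitely many families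
of vectors indexed by finite sets of letters. Enlarging the set of fixed letters allows redundant
families to be discarded, so such families can be made linearly independent modulo a given subobject
(`Fam.exists_linearIndependent`). Hence a subobject with cyclic quotient has a complement stable
under some `fix A`, and the projection onto it is equivariant for `fix A` only
(`exists_retraction`). Full equivariance is recovered by averaging (`ConstTerms.exists_average`):
conjugate the map so that a letter `a` of `A` becomes a fresh letter `b`, then take the constant
term of the value in `ξ_b`. The result does not depend on `b`, and values that are already
equivariant are unchanged. This extends equivariant maps one vector at a time, and Zorn's lemma
finishes (`ConstTerms.injective`). Constant terms act componentwise, so infinite direct sums need no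
separate argument.

Embedding. The same averaging, after multiplication by a suitable power of a variable, turns a
coordinate map of a cyclic object into a non-zero morphism to `𝐈^r` (`Fam.exists_hom_ne_zero`). A
subobject chosen minimal for the size of `T` and then for the dimension of the quotient by `low T`
makes such a morphism injective (`exists_subobject_of_I`).

Conclusion. An endomorphism of `𝐈^r` is diagonal with conjugate entries, so it is zero or injective.
With injectivity this shows that `𝐈^r` is indecomposable and that its non-zero subobjects are
essential. In an injective object, the sum of a maximal independent set of copies of various `𝐈^r`
splits off; a non-zero complement would contain one more copy. -/

noncomputable section

open scoped Pointwise

namespace SemilinRep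

/-! ### Finite supports -/

/-- The pointwise stabilizer of a finite set of letters. -/
def fix (A : Finset ℕ) : Subgroup infSymm := fixingSubgroup infSymm (A : Set ℕ)

theorem mem_fix {A : Finset ℕ} {σ : infSymm} : σ ∈ fix A ↔ ∀ i ∈ A, σ • i = i := by
  simp [fix, mem_fixingSubgroup_iff]

theorem fix_anti {A B : Finset ℕ} (h : A ⊆ B) : fix B ≤ fix A :=
  fun _ hσ => mem_fix.2 fun i hi => mem_fix.1 hσ i (h hi)

theorem fix_empty (σ : infSymm) : σ ∈ fix ∅ := mem_fix.2 (by simp)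

/-- The transposition of two letters. -/
def swap (a b : ℕ) : infSymm :=
  ⟨Equiv.swap a b, max a b + 1, fun i hi => Equiv.swap_apply_of_ne_of_ne (by grind) (by grind)⟩

@[simp] theorem swap_smul_left (a b : ℕ) : swap a b • a = b := Equiv.swap_apply_left a b

@[simp] theorem swap_smul_right (a b : ℕ) : swap a b • b = a := Equiv.swap_apply_right a b

theorem swap_smul_of_ne {a b i : ℕ} (ha : i ≠ a) (hb : i ≠ b) : swap a b • i = i :=
  Equiv.swap_apply_of_ne_of_ne ha hb

@[simp] theorem swap_smul_swap_smul {X : Type*} [MulAction infSymm X] (a b : ℕ) (x : X) :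
    swap a b • swap a b • x = x := by
  rw [smul_smul, show swap a b * swap a b = 1 from Subtype.ext (Equiv.swap_mul_self a b), one_smul]

theorem swap_mem_fix {A : Finset ℕ} {a b : ℕ} (ha : a ∉ A) (hb : b ∉ A) : swap a b ∈ fix A :=
  mem_fix.2 fun i hi => swap_smul_of_ne (by grind) (by grind)

theorem smul_finset_of_mem_fix {A S : Finset ℕ} {σ : infSymm} (hσ : σ ∈ fix A) (h : S ⊆ A) :
    σ • S = S := by
  ext i
  rw [Finset.mem_smul_finset]
  constructor
  · rintro ⟨j, hj, rfl⟩
    rwa [mem_fix.1 hσ j (h hj)]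
  · exact fun hi => ⟨i, hi, mem_fix.1 hσ i (h hi)⟩

theorem disjoint_smul {A S : Finset ℕ} {σ : infSymm} (hσ : σ ∈ fix A) (h : Disjoint S A) :
    Disjoint (σ • S) A := by
  rw [← smul_finset_of_mem_fix hσ (subset_refl A)]
  rw [Finset.disjoint_left] at h ⊢
  intro i hi hi'
  obtain ⟨j, hj, rfl⟩ := Finset.mem_smul_finset.1 hi
  exact h hj ((Finset.smul_mem_smul_finset_iff σ).1 hi')

theorem conj_mem_fix {A : Finset ℕ} {σ τ : infSymm} (h : σ ∈ fix (τ • A)) :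
    τ⁻¹ * σ * τ ∈ fix A := by
  refine mem_fix.2 fun i hi => ?_
  rw [mul_smul, mul_smul, mem_fix.1 h _ (Finset.smul_mem_smul_finset hi), inv_smul_smul]

/-- Induction on the size of `S \ T`: a transposition exchanging a letter of `S \ T` with one of `T
\ S` fixes `A` and lowers that size. -/
theorem exists_smul_eq {A S T : Finset ℕ} (hc : S.card = T.card) (hS : Disjoint S A)
    (hT : Disjoint T A) : ∃ σ ∈ fix A, σ • S = T := by
  induction hn : (S \ T).card generalizing S with
  | zero =>
    refine ⟨1, one_mem _, ?_⟩
    rw [one_smul]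
    refine Finset.eq_of_subset_of_card_le ?_ hc.ge
    rwa [Finset.card_eq_zero, Finset.sdiff_eq_empty_iff_subset] at hn
  | succ n ih =>
    have h1 : (T \ S).card = (S \ T).card := (Finset.card_sdiff_comm hc).symm
    obtain ⟨s, hs⟩ : (S \ T).Nonempty := Finset.card_pos.1 (by omega)
    obtain ⟨t, ht⟩ : (T \ S).Nonempty := Finset.card_pos.1 (by omega)
    rw [Finset.mem_sdiff] at hs ht
    have hsA := Finset.disjoint_left.1 hS hs.1
    have htA := Finset.disjoint_left.1 hT ht.1
    have hf := swap_mem_fix hsA htA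
    have key : swap s t • S = insert t (S.erase s) := by
      ext i
      rw [Finset.mem_smul_finset]
      constructor
      · rintro ⟨j, hj, rfl⟩
        by_cases hjs : j = s
        · simp [hjs]
        · rw [swap_smul_of_ne hjs (by grind)]; grind
      · intro hi
        rcases Finset.mem_insert.1 hi with rfl | hi
        · exact ⟨s, hs.1, by simp⟩
        · exact ⟨i, by grind, swap_smul_of_ne (by grind) (by grind)⟩
    obtain ⟨σ, hσ, h⟩ := ih (S := swap s t • S) (by simpa using hc) (disjoint_smul hf hS) (by
      have hST : insert t (S.erase s) \ T = (S \ T).erase s := by clear ih; ext; grind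
      rw [key, hST,
        Finset.card_erase_of_mem (by grind)]
      omega)
    exact ⟨σ * swap s t, mul_mem hσ hf, by rw [mul_smul, h]⟩

theorem exists_notMem (S : Finset ℕ) : ∃ b, b ∉ S := Infinite.exists_notMem_finset S

theorem exists_smul_disjoint (A S : Finset ℕ) : ∃ σ : infSymm, Disjoint (σ • A) S := by
  obtain ⟨T, hT, hc⟩ := Infinite.exists_superset_card_eq (S : Finset ℕ) (S.card + A.card) (by omega)
  obtain ⟨σ, -, h⟩ := exists_smul_eq (A := ∅) (S := A) (T := T \ S)
    (by rw [Finset.card_sdiff_of_subset hT]; omega) (by simp) (by simp)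
  exact ⟨σ, h ▸ Finset.sdiff_disjoint⟩

/-- `x` is stabilized by the permutations that fix each letter of `S`. -/
def SupportedBy {X : Type*} [SMul infSymm X] (S : Finset ℕ) (x : X) : Prop := ∀ σ ∈ fix S, σ • x = x

theorem IsSmooth.exists_supportedBy {X : Type*} [SMul infSymm X] (h : IsSmooth X) (x : X) :
    ∃ S, SupportedBy S x := by
  obtain ⟨n, hn⟩ := h x
  exact ⟨Finset.range n, fun σ hσ => hn σ fun i hi => mem_fix.1 hσ i (Finset.mem_range.2 hi)⟩

namespace SupportedBy

variable {X : Type*} {S T : Finset ℕ}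

theorem mono [SMul infSymm X] {x : X} (h : SupportedBy S x) (hST : S ⊆ T) : SupportedBy T x :=
  fun σ hσ => h σ (fix_anti hST hσ)

theorem smul [MulAction infSymm X] {x : X} (h : SupportedBy S x) (σ : infSymm) :
    SupportedBy (σ • S) (σ • x) := fun τ hτ => by
  have := h _ (conj_mem_fix hτ)
  rw [mul_smul, mul_smul, inv_smul_eq_iff] at this
  exact this

theorem zero [AddMonoid X] [DistribMulAction infSymm X] : SupportedBy S (0 : X) :=
  fun σ _ => smul_zero σ

theorem add [AddMonoid X] [DistribMulAction infSymm X] {x y : X} (hx : SupportedBy S x)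
    (hy : SupportedBy S y) : SupportedBy S (x + y) := fun σ hσ => by
  rw [smul_add, hx σ hσ, hy σ hσ]

end SupportedBy

end SemilinRep
namespace SemilinRep

/-! ### Constant terms -/

section ConstantTerm

variable {k : Type u} [Field k]

variable (k) in
/-- The variable `ξ_i`, as an element of `𝐊`. -/
def xi (i : ℕ) : RatFun k := algebraMap (MvPolynomial ℕ k) (RatFun k) (MvPolynomial.X i)

theorem smul_xi (σ : infSymm) (i : ℕ) : σ • xi k i = xi k (σ • i) := by
  rw [xi, smul_algebraMap, MvPolynomial.rename_X]
  rfl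

theorem xi_injective : Function.Injective (xi k) := fun _ _ h =>
  MvPolynomial.X_injective (IsFractionRing.injective (MvPolynomial ℕ k) (RatFun k) h)

theorem smul_algebraMap_const (σ : infSymm) (c : k) :
    σ • algebraMap k (RatFun k) c = algebraMap k (RatFun k) c := (ratAct k σ).commutes c

theorem ratFun_ringHom_ext {R : Type*} [CommRing R] {f g : RatFun k →+* R}
    (hC : ∀ c : k, f (algebraMap k _ c) = g (algebraMap k _ c))
    (hX : ∀ i, f (xi k i) = g (xi k i)) : f = g := by
  refine IsLocalization.ringHom_ext (nonZeroDivisors (MvPolynomial ℕ k)) ?_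
  refine MvPolynomial.ringHom_ext (fun c => ?_) hX
  have := hC c
  rwa [IsScalarTower.algebraMap_apply k (MvPolynomial ℕ k) (RatFun k)] at this

variable (k) in
/-- The polynomials, viewed as polynomials in the variable `ξ_b`. -/
def polyIn (b : ℕ) : MvPolynomial ℕ k →+* Polynomial (MvPolynomial ℕ k) :=
  MvPolynomial.eval₂Hom (Polynomial.C.comp MvPolynomial.C)
    fun i => if i = b then Polynomial.X else Polynomial.C (MvPolynomial.X i)

theorem polyIn_injective (b : ℕ) : Function.Injective (polyIn k b) := by
  have : (Polynomial.evalRingHom (MvPolynomial.X b)).comp (polyIn k b) = RingHom.id _ := by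
    refine MvPolynomial.ringHom_ext (fun c => by simp [polyIn]) fun i => ?_
    by_cases h : i = b <;> simp [polyIn, h]
  exact Function.LeftInverse.injective (g := Polynomial.evalRingHom (MvPolynomial.X b))
    fun p => DFunLike.congr_fun this p

variable (k) in
/-- The expansion of a polynomial as a Laurent series in the variable `ξ_b`. -/
def polyExpand (b : ℕ) : MvPolynomial ℕ k →+* HahnSeries ℤ (RatFun k) :=
  (HahnSeries.ofPowerSeries ℤ (RatFun k)).comp (Polynomial.coeToPowerSeries.ringHom.comp
    ((Polynomial.mapRingHom (algebraMap (MvPolynomial ℕ k) (RatFun k))).comp (polyIn k b)))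

theorem polyExpand_injective (b : ℕ) : Function.Injective (polyExpand k b) := by
  intro p q h
  have h1 := HahnSeries.ofPowerSeries_injective h
  have h2 := Polynomial.coe_injective _ h1
  exact polyIn_injective b (Polynomial.map_injective _ (IsFractionRing.injective _ _) h2)

variable (k) in
/-- The expansion of a rational function as a Laurent series in the variable `ξ_b`. -/
def expand (b : ℕ) : RatFun k →+* HahnSeries ℤ (RatFun k) :=
  IsFractionRing.lift (polyExpand_injective (k := k) b)

theorem expand_algebraMap (b : ℕ) (p : MvPolynomial ℕ k) :
    expand k b (algebraMap _ _ p) = polyExpand k b p := IsFractionRing.lift_algebraMap _ _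

theorem expand_const (b : ℕ) (c : k) :
    expand k b (algebraMap k _ c) = HahnSeries.C (algebraMap k _ c) := by
  rw [IsScalarTower.algebraMap_apply k (MvPolynomial ℕ k) (RatFun k), expand_algebraMap]
  simp [polyExpand, polyIn, MvPolynomial.algebraMap_eq]

theorem expand_xi_self (b : ℕ) : expand k b (xi k b) = HahnSeries.single 1 1 := by
  rw [xi, expand_algebraMap]
  simp [polyExpand, polyIn]

theorem expand_xi_of_ne {i b : ℕ} (h : i ≠ b) : expand k b (xi k i) = HahnSeries.C (xi k i) := by
  rw [xi, expand_algebraMap]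
  simp [polyExpand, polyIn, h]

/-- The action of a permutation on the coefficients of a Laurent series. -/
def coeffAct (σ : infSymm) : HahnSeries ℤ (RatFun k) →+* HahnSeries ℤ (RatFun k) where
  toFun x := x.map (MulSemiringAction.toRingHom infSymm (RatFun k) σ)
  map_one' := by ext n; simp [HahnSeries.coeff_one]
  map_zero' := by ext n; simp
  map_add' x y := by ext n; simp
  map_mul' x y := by
    have hs : ∀ x : HahnSeries ℤ (RatFun k),
        (x.map (MulSemiringAction.toRingHom infSymm (RatFun k) σ)).support = x.support := by
      intro x; ext n; simp [smul_eq_zero_iff_eq]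
    ext n
    simp only [HahnSeries.coeff_mul, HahnSeries.map_coeff, map_sum, map_mul]
    refine Finset.sum_congr ?_ fun _ _ => rfl
    ext p
    simp only [Finset.mem_antidiagonal, hs]

theorem coeff_coeffAct (σ : infSymm) (x : HahnSeries ℤ (RatFun k)) (n : ℤ) :
    (coeffAct σ x).coeff n = σ • x.coeff n := rfl

theorem expand_smul (σ : infSymm) (b : ℕ) (x : RatFun k) :
    expand k (σ • b) (σ • x) = coeffAct σ (expand k b x) := by
  have hCC : ∀ c : RatFun k, coeffAct σ (HahnSeries.C c) = HahnSeries.C (σ • c) := by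
    intro c; ext n
    simp [coeff_coeffAct, HahnSeries.coeff_single, apply_ite (σ • · : RatFun k → RatFun k)]
  suffices (expand k (σ • b)).comp (MulSemiringAction.toRingHom infSymm (RatFun k) σ) =
    (coeffAct σ).comp (expand k b) from DFunLike.congr_fun this x
  refine ratFun_ringHom_ext (fun c => ?_) fun i => ?_
  · rw [RingHom.comp_apply, RingHom.comp_apply, MulSemiringAction.toRingHom_apply,
      smul_algebraMap_const, expand_const, expand_const, hCC, smul_algebraMap_const]
  · by_cases h : i = b
    · subst h
      simp only [RingHom.comp_apply, MulSemiringAction.toRingHom_apply, smul_xi, expand_xi_self]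
      ext n
      simp [coeff_coeffAct, HahnSeries.coeff_single, apply_ite (σ • · : RatFun k → RatFun k)]
    · have : σ • i ≠ σ • b := fun h' => h (smul_left_cancel σ h')
      rw [RingHom.comp_apply, RingHom.comp_apply, MulSemiringAction.toRingHom_apply, smul_xi,
        expand_xi_of_ne h, expand_xi_of_ne this, hCC, smul_xi]

/-- The rational function `x` does not involve the variable `ξ_b`. -/
def FreeOf (b : ℕ) (x : RatFun k) : Prop := ∃ p q : MvPolynomial ℕ k, b ∉ p.vars ∧ b ∉ q.vars ∧
  x = algebraMap _ (RatFun k) p / algebraMap _ (RatFun k) q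

/-- Write `x` as a fraction and exchange `b` with a letter `c` outside `S` and outside the fraction:
`x` does not change, while `ξ_b` disappears from numerator and denominator. -/
theorem freeOf_of_supportedBy {S : Finset ℕ} {b : ℕ} {x : RatFun k} (hx : SupportedBy S x)
    (hb : b ∉ S) : FreeOf b x := by
  obtain ⟨p, q, -, rfl⟩ := IsFractionRing.div_surjective (MvPolynomial ℕ k) x
  obtain ⟨c, hc⟩ := exists_notMem (S ∪ p.vars ∪ q.vars)
  simp only [Finset.mem_union, not_or] at hc
  have key : ∀ r : MvPolynomial ℕ k, c ∉ r.vars →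
      b ∉ (MvPolynomial.rename ((swap b c : infSymm) : Equiv.Perm ℕ) r).vars := by
    intro r hr hb'
    obtain ⟨i, hi, h⟩ := Finset.mem_image.1 (MvPolynomial.vars_rename _ _ hb')
    have : i = c := by
      have h' : swap b c • i = swap b c • c := h.trans (swap_smul_right b c).symm
      exact smul_left_cancel _ h'
    exact hr (this ▸ hi)
  refine ⟨_, _, key p hc.1.2, key q hc.2, ?_⟩
  rw [← smul_algebraMap, ← smul_algebraMap, ← smul_div₀', hx _ (swap_mem_fix hb hc.1.1)]

theorem FreeOf.hom_congr {L : Type*} [Field L] {b : ℕ} {x : RatFun k} (hx : FreeOf b x)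
    {f g : RatFun k →+* L} (hC : ∀ c : k, f (algebraMap k _ c) = g (algebraMap k _ c))
    (hX : ∀ i, i ≠ b → f (xi k i) = g (xi k i)) : f x = g x := by
  obtain ⟨p, q, hp, hq, rfl⟩ := hx
  have key : ∀ r : MvPolynomial ℕ k, b ∉ r.vars → f (algebraMap _ _ r) = g (algebraMap _ _ r) := by
    intro r hr
    refine MvPolynomial.hom_congr_vars (f₁ := f.comp (algebraMap _ _))
      (f₂ := g.comp (algebraMap _ _)) ?_ (fun i hi _ => hX i (by grind)) rfl
    ext c
    have := hC c
    rwa [IsScalarTower.algebraMap_apply k (MvPolynomial ℕ k) (RatFun k)] at this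
  rw [map_div₀, map_div₀, key p hp, key q hq]

theorem FreeOf.expand_eq {b : ℕ} {x : RatFun k} (hx : FreeOf b x) :
    expand k b x = HahnSeries.C x :=
  hx.hom_congr (f := expand k b) (g := HahnSeries.C) (expand_const b) fun _ hi => expand_xi_of_ne hi

/-- Both sides are ring homomorphisms in `x` that agree on constants and on all variables except
`ξ_c`. -/
theorem FreeOf.expand_swap {b c : ℕ} {x : RatFun k} (hx : FreeOf c x) :
    expand k c (swap b c • x) = expand k b x := by
  refine hx.hom_congr
    (f := (expand k c).comp (MulSemiringAction.toRingHom infSymm (RatFun k) (swap b c)))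
    (fun a => ?_) fun i hi => ?_
  · rw [RingHom.comp_apply, MulSemiringAction.toRingHom_apply, smul_algebraMap_const, expand_const,
      expand_const]
  · rw [RingHom.comp_apply, MulSemiringAction.toRingHom_apply, smul_xi]
    by_cases h : i = b
    · rw [h, swap_smul_left, expand_xi_self, expand_xi_self]
    · rw [swap_smul_of_ne h hi, expand_xi_of_ne hi, expand_xi_of_ne h]

variable (k) in
/-- The constant term of the Laurent expansion in the variable `ξ_b`. -/
def constTerm (b : ℕ) : RatFun k →ₗ[k] RatFun k where
  toFun x := (expand k b x).coeff 0
  map_add' x y := by simp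
  map_smul' c x := by
    rw [Algebra.smul_def, map_mul, expand_const, HahnSeries.C_mul_eq_smul, HahnSeries.coeff_smul,
      smul_eq_mul, RingHom.id_apply, Algebra.smul_def]

theorem constTerm_mul {b : ℕ} {c : RatFun k} (hc : FreeOf b c) (x : RatFun k) :
    constTerm k b (c * x) = c * constTerm k b x := by
  change (expand k b (c * x)).coeff 0 = c * (expand k b x).coeff 0
  rw [map_mul, hc.expand_eq, HahnSeries.C_mul_eq_smul, HahnSeries.coeff_smul, smul_eq_mul]

theorem constTerm_of_freeOf {b : ℕ} {x : RatFun k} (hx : FreeOf b x) : constTerm k b x = x := by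
  change (expand k b x).coeff 0 = x
  rw [hx.expand_eq, HahnSeries.C_apply, HahnSeries.coeff_single_same]

theorem smul_constTerm (σ : infSymm) (b : ℕ) (x : RatFun k) :
    σ • constTerm k b x = constTerm k (σ • b) (σ • x) := by
  change σ • (expand k b x).coeff 0 = (expand k (σ • b) (σ • x)).coeff 0
  rw [expand_smul, coeff_coeffAct]

theorem swap_smul_constTerm {b c : ℕ} {x : RatFun k} (hx : FreeOf c x) :
    swap b c • constTerm k b x = constTerm k b x := by
  rw [smul_constTerm, swap_smul_left]
  change (expand k c (swap b c • x)).coeff 0 = (expand k b x).coeff 0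
  rw [hx.expand_swap]

/-- A power of `ξ_a` shifts some non-zero Laurent coefficient into degree zero. -/
theorem exists_constTerm_mul_ne_zero (a : ℕ) {x : RatFun k} (hx : x ≠ 0) :
    ∃ h : RatFun k, SupportedBy {a} h ∧ constTerm k a (h * x) ≠ 0 := by
  have h1 : expand k a x ≠ 0 := (map_ne_zero (expand k a)).2 hx
  obtain ⟨n, hn⟩ : ∃ n, (expand k a x).coeff n ≠ 0 := by
    by_contra! h
    exact h1 (HahnSeries.ext (funext h))
  have hpow : ∀ m : ℤ, (HahnSeries.single (1 : ℤ) (1 : RatFun k)) ^ m = HahnSeries.single m 1 :=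
    fun m => (RatFunc.single_zpow m).symm
  refine ⟨xi k a ^ (-n), fun σ hσ => ?_, ?_⟩
  · rw [smul_zpow₀', smul_xi, mem_fix.1 hσ a (by simp)]
  · change (expand k a (xi k a ^ (-n) * x)).coeff 0 ≠ 0
    rw [map_mul, map_zpow₀, expand_xi_self, hpow]
    have := HahnSeries.coeff_single_mul_add (r := (1 : RatFun k)) (x := expand k a x) (a := n)
      (b := -n)
    rw [add_neg_cancel, one_mul] at this
    rwa [this]

end ConstantTerm
end SemilinRep
namespace SmoothSemilinRep

open SemilinRep

variable {k : Type u} [Field k]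

theorem exists_supportedBy (M : SmoothSemilinRep k) (x : M) : ∃ S, SupportedBy S x :=
  M.smooth.exists_supportedBy x

theorem supportedBy_smul {M : SmoothSemilinRep k} {S : Finset ℕ} {a : RatFun k} {x : M}
    (ha : SupportedBy S a) (hx : SupportedBy S x) : SupportedBy S (a • x) := fun σ hσ => by
  rw [M.semilinear, ha σ hσ, hx σ hσ]

theorem repr_smul_smul {M : SmoothSemilinRep k} {X : Type*} [MulAction infSymm X]
    (b : Module.Basis X (RatFun k) M) (hb : ∀ (σ : infSymm) x, σ • b x = b (σ • x))
    (σ : infSymm) (m : M) (x : X) : b.repr (σ • m) (σ • x) = σ • b.repr m x := by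
  classical
  induction b.mem_span m using Submodule.span_induction with
  | mem m hm =>
    obtain ⟨y, rfl⟩ := hm
    rw [hb, b.repr_self, b.repr_self, Finsupp.single_apply, Finsupp.single_apply]
    by_cases h : y = x
    · simp [h]
    · rw [if_neg h, if_neg fun h' => h (smul_left_cancel σ h'), smul_zero]
  | zero => simp
  | add m n _ _ hm hn => simp [hm, hn]
  | smul a m _ hm => simp [M.semilinear, hm, smul_mul']

/-! ### Coordinates on `𝐈^r` -/

theorem coe_smul_powersetCard {r : ℕ} (σ : infSymm) (S : Set.powersetCard ℕ r) :
    ((σ • S : Set.powersetCard ℕ r) : Finset ℕ) = σ • (S : Finset ℕ) := rfl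

variable (k) in
/-- The basis of `𝐈^r` given by the vectors `1 ⊗ e_S`. -/
def basisI (r : ℕ) : Module.Basis (Set.powersetCard ℕ r) (RatFun k) (I k r) :=
  Algebra.TensorProduct.basis (RatFun k) (Finsupp.basisSingleOne (R := k))

theorem basisI_apply {r : ℕ} (S : Set.powersetCard ℕ r) :
    basisI k r S = pureTensor 1 (Finsupp.single S 1) := by
  change Algebra.TensorProduct.basis (RatFun k) (Finsupp.basisSingleOne (R := k)) S = _
  rw [Algebra.TensorProduct.basis_apply, Finsupp.coe_basisSingleOne]
  rfl

theorem smul_basisI {r : ℕ} (σ : infSymm) (S : Set.powersetCard ℕ r) :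
    σ • basisI k r S = basisI k r (σ • S) := by
  rw [basisI_apply, basisI_apply]
  refine (smul_pureTensor _ _ _).trans ?_
  simp [vAct]

theorem repr_smul {r : ℕ} (σ : infSymm) (x : I k r) (S : Set.powersetCard ℕ r) :
    (basisI k r).repr (σ • x) (σ • S) = σ • (basisI k r).repr x S :=
  repr_smul_smul _ smul_basisI σ x S

/-- A letter of `U` outside `S` could be exchanged with a letter that occurs in no set of the finite
expansion of `x`, without changing `x`; this would produce a non-zero coordinate at a set that does
not occur. -/
theorem SupportedBy.subset_of_repr_ne_zero {r : ℕ} {S : Finset ℕ} {x : I k r}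
    (hx : SupportedBy S x) {U : Set.powersetCard ℕ r} (hU : (basisI k r).repr x U ≠ 0) :
    (U : Finset ℕ) ⊆ S := by
  intro u hu
  by_contra huS
  obtain ⟨c, hc⟩ := exists_notMem (S ∪
    ((basisI k r).repr x).support.biUnion fun V => (V : Finset ℕ))
  simp only [Finset.mem_union, not_or, Finset.mem_biUnion, not_exists, not_and] at hc
  have h := repr_smul (swap u c) x U
  rw [hx _ (swap_mem_fix huS hc.1)] at h
  refine hc.2 (swap u c • U) ?_ ?_
  · rw [Finsupp.mem_support_iff, h, Ne, smul_eq_zero_iff_eq]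
    exact hU
  · rw [coe_smul_powersetCard]
    exact Finset.mem_smul_finset.2 ⟨u, hu, by simp⟩

theorem SupportedBy.repr {r : ℕ} {S : Finset ℕ} {x : I k r}
    (hx : SupportedBy S x) (U : Set.powersetCard ℕ r) :
    SupportedBy S ((basisI k r).repr x U) := by
  by_cases hU : (basisI k r).repr x U = 0
  · rw [hU]; exact SupportedBy.zero
  intro σ hσ
  have h := repr_smul σ x U
  rw [hx σ hσ] at h
  rw [← h]
  congr 1
  apply Subtype.ext
  rw [coe_smul_powersetCard]
  exact smul_finset_of_mem_fix hσ (SupportedBy.subset_of_repr_ne_zero hx hU)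

/-! ### Constant terms of vectors -/

/-- Operators on an object that behave like the passage to the constant term with respect to one of
the variables `ξ_b`. -/
structure ConstTerms (Q : SmoothSemilinRep k) where
  ct : ℕ → Q →+ Q
  ct_smul : ∀ {b : ℕ} {c : RatFun k} (q : Q), FreeOf b c → ct b (c • q) = c • ct b q
  smul_ct : ∀ (σ : infSymm) (b : ℕ) (q : Q), σ • ct b q = ct (σ • b) (σ • q)
  ct_of_notMem : ∀ {S : Finset ℕ} {b : ℕ} {q : Q}, SupportedBy S q → b ∉ S → ct b q = q
  swap_smul_ct : ∀ {S : Finset ℕ} {c : ℕ} (b : ℕ) {q : Q}, SupportedBy S q → c ∉ S →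
    swap b c • ct b q = ct b q

variable (k) in
/-- The constant term operators on `𝐈^r`; they kill `e_S` if `b ∈ S`. -/
def ctI (r : ℕ) (b : ℕ) : I k r →+ I k r :=
  ((basisI k r).repr.symm.toLinearMap.toAddMonoidHom.comp
    (Finsupp.filterAddHom fun S : Set.powersetCard ℕ r => b ∉ (S : Finset ℕ))).comp
  ((Finsupp.mapRange.addMonoidHom (constTerm k b).toAddMonoidHom).comp
    (basisI k r).repr.toLinearMap.toAddMonoidHom)

theorem repr_ctI_of_mem {r b : ℕ} {S : Set.powersetCard ℕ r} (h : b ∈ (S : Finset ℕ)) (x : I k r) :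
    (basisI k r).repr (ctI k r b x) S = 0 := by
  change (basisI k r).repr ((basisI k r).repr.symm (Finsupp.filter _ _)) S = 0
  rw [LinearEquiv.apply_symm_apply]
  exact Finsupp.filter_apply_neg _ _ (not_not.2 h)

theorem repr_ctI_of_notMem {r b : ℕ} {S : Set.powersetCard ℕ r} (h : b ∉ (S : Finset ℕ))
    (x : I k r) :
    (basisI k r).repr (ctI k r b x) S = constTerm k b ((basisI k r).repr x S) := by
  change (basisI k r).repr ((basisI k r).repr.symm (Finsupp.filter _ _)) S = _
  rw [LinearEquiv.apply_symm_apply]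
  exact Finsupp.filter_apply_pos _ _ h

-- Discarding the coordinates at sets containing `b` is what makes `swap_smul_ct` true: the
-- transposition of `b` and `c` would carry them to sets containing the fresh letter `c`. It does no
-- harm in `ct_of_notMem`, where no such coordinate occurs.
variable (k) in
def constTermsI (r : ℕ) : ConstTerms (I k r) where
  ct := ctI k r
  ct_smul {b c} q h := by
    refine (basisI k r).ext_elem fun S => ?_
    by_cases hS : b ∈ (S : Finset ℕ)
    · simp [repr_ctI_of_mem hS]
    · simp [repr_ctI_of_notMem hS, constTerm_mul h]
  smul_ct σ b q := by
    refine (basisI k r).ext_elem fun S => ?_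
    obtain ⟨S, rfl⟩ : ∃ T, S = σ • T := ⟨σ⁻¹ • S, by simp⟩
    have hm : σ • b ∈ ((σ • S : Set.powersetCard ℕ r) : Finset ℕ) ↔ b ∈ (S : Finset ℕ) := by
      rw [coe_smul_powersetCard, Finset.smul_mem_smul_finset_iff]
    rw [repr_smul]
    by_cases hS : b ∈ (S : Finset ℕ)
    · rw [repr_ctI_of_mem hS, repr_ctI_of_mem (hm.2 hS), smul_zero]
    · rw [repr_ctI_of_notMem hS, repr_ctI_of_notMem (hm.not.2 hS), smul_constTerm, repr_smul]
  ct_of_notMem {S b q} hq hb := by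
    refine (basisI k r).ext_elem fun U => ?_
    by_cases hU : b ∈ (U : Finset ℕ)
    · rw [repr_ctI_of_mem hU]
      by_contra h
      exact hb (SupportedBy.subset_of_repr_ne_zero hq (Ne.symm h) hU)
    · rw [repr_ctI_of_notMem hU,
        constTerm_of_freeOf (freeOf_of_supportedBy (SupportedBy.repr hq U) hb)]
  swap_smul_ct {S c} b {q} hq hc := by
    refine (basisI k r).ext_elem fun U => ?_
    obtain ⟨U, rfl⟩ : ∃ T, U = swap b c • T := ⟨swap b c • U, by simp⟩
    rw [repr_smul]
    have hm : b ∈ ((swap b c • U : Set.powersetCard ℕ r) : Finset ℕ) ↔ c ∈ (U : Finset ℕ) := by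
      rw [coe_smul_powersetCard, ← Finset.smul_mem_smul_finset_iff (swap b c) (b := c),
        swap_smul_right]
    by_cases hcU : c ∈ (U : Finset ℕ)
    · rw [repr_ctI_of_mem (hm.2 hcU)]
      by_cases hb : b ∈ (U : Finset ℕ)
      · rw [repr_ctI_of_mem hb, smul_zero]
      · rw [repr_ctI_of_notMem hb]
        by_cases h : (basisI k r).repr q U = 0
        · rw [h, map_zero, smul_zero]
        · exact absurd (SupportedBy.subset_of_repr_ne_zero hq h hcU) hc
    · rw [repr_ctI_of_notMem (hm.not.2 hcU)]
      by_cases hb : b ∈ (U : Finset ℕ)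
      · rw [repr_ctI_of_mem hb, smul_zero]
        by_cases h : (basisI k r).repr q (swap b c • U) = 0
        · rw [h, map_zero]
        · refine absurd (SupportedBy.subset_of_repr_ne_zero hq h ?_) hc
          rw [coe_smul_powersetCard]
          exact Finset.mem_smul_finset.2 ⟨b, hb, by simp⟩
      · rw [repr_ctI_of_notMem hb, show swap b c • U = U from ?_,
          swap_smul_constTerm (freeOf_of_supportedBy (SupportedBy.repr hq U) hc)]
        apply Subtype.ext
        rw [coe_smul_powersetCard]
        exact smul_finset_of_mem_fix (swap_mem_fix hb hcU) subset_rfl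

/-- Constant terms on a direct sum are formed componentwise. -/
def ConstTerms.directSum {ι : Type u} {M : ι → SmoothSemilinRep k} (h : ∀ i, ConstTerms (M i)) :
    ConstTerms (directSum M) where
  ct b := DFinsupp.mapRange.addMonoidHom fun i => (h i).ct b
  ct_smul q hc := DFinsupp.ext fun i => (h i).ct_smul ((show Π₀ i, M i from q) i) hc
  smul_ct σ b q := DFinsupp.ext fun i => (h i).smul_ct σ b ((show Π₀ i, M i from q) i)
  ct_of_notMem hq hb := DFinsupp.ext fun i =>
    (h i).ct_of_notMem (fun σ hσ => DFunLike.congr_fun (F := Π₀ i, M i) (hq σ hσ) i) hb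
  swap_smul_ct b _ hq hc := DFinsupp.ext fun i =>
    (h i).swap_smul_ct b (fun σ hσ => DFunLike.congr_fun (F := Π₀ i, M i) (hq σ hσ) i) hc

end SmoothSemilinRep
namespace SmoothSemilinRep

open SemilinRep

variable {k : Type u} [Field k]

/-! ### Averaging -/

theorem smul_swap_smul {X : Type*} [MulAction infSymm X] (σ : infSymm) (a b : ℕ) (x : X) :
    σ • swap a b • x = swap (σ • a) (σ • b) • σ • x := by
  rw [smul_smul, smul_smul]
  congr 1
  exact Subtype.ext (Equiv.mul_swap_eq_swap_mul _ _ _)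

/-- A linear map commutes with the permutations that fix each letter of `A`. -/
def FixEquivariant {M Q : SmoothSemilinRep k} (A : Finset ℕ) (f : M →ₗ[RatFun k] Q) : Prop :=
  ∀ σ ∈ fix A, ∀ x, f (σ • x) = σ • f x

theorem FixEquivariant.supportedBy {M Q : SmoothSemilinRep k} {A S : Finset ℕ}
    {f : M →ₗ[RatFun k] Q} (hf : FixEquivariant A f) {x : M} (hx : SupportedBy S x) :
    SupportedBy (S ∪ A) (f x) := fun σ hσ => by
  rw [← hf σ (fix_anti Finset.subset_union_right hσ),
    hx σ (fix_anti Finset.subset_union_left hσ)]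

namespace ConstTerms

variable {M Q : SmoothSemilinRep k} (c : ConstTerms Q) {a : ℕ} {A : Finset ℕ}
  {f : M →ₗ[RatFun k] Q}

/-- The letter `b` stands for a generic letter. The conjugated value is supported by `S`, `A` and
`b`, so its constant term in `ξ_b` is fixed by the transposition of `b` and `d`, which also carries
the left side to the right side. -/
theorem ct_swap_congr (hf : FixEquivariant (insert a A) f) {S : Finset ℕ} {y : M}
    (hy : SupportedBy S y) {b d : ℕ} (hbS : b ∉ S) (hbA : b ∉ insert a A) (hdS : d ∉ S)
    (hdA : d ∉ insert a A) :
    c.ct b (swap a b • f (swap a b • y)) = c.ct d (swap a d • f (swap a d • y)) := by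
  by_cases hbd : b = d
  · rw [hbd]
  have hba : b ≠ a := by grind
  have hda : d ≠ a := by grind
  have hσA := swap_mem_fix hbA hdA
  have hu := (hf.supportedBy (hy.smul (swap a b))).smul (swap a b)
  have hd : d ∉ swap a b • (swap a b • S ∪ insert a A) := by
    intro h
    rw [Finset.smul_finset_union, swap_smul_swap_smul, Finset.mem_union] at h
    rcases h with h | h
    · exact hdS h
    · obtain ⟨i, hi, h⟩ := Finset.mem_smul_finset.1 h
      have : i = d := by
        rw [← swap_smul_swap_smul a b i, h, swap_smul_of_ne hda (Ne.symm hbd)]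
      exact hdA (this ▸ hi)
  rw [← c.swap_smul_ct b hu hd, c.smul_ct, swap_smul_left, smul_swap_smul, ← hf _ hσA,
    smul_swap_smul, hy _ (swap_mem_fix hbS hdS), swap_smul_left,
    swap_smul_of_ne hba.symm hda.symm]

/-- Removes one letter from the set whose fixing is needed for equivariance. Since the value is the
same for all fresh `b`, a common `b` can be chosen for the finitely many vectors and scalars in each
identity; linearity over `𝐊` then holds because the scalar does not involve `ξ_b`. -/
theorem exists_average (ha : a ∉ A) (hf : FixEquivariant (insert a A) f) :
    ∃ g : M →ₗ[RatFun k] Q, FixEquivariant A g ∧ ∀ (S : Finset ℕ) (y : M) (b : ℕ),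
      SupportedBy S y → b ∉ S → b ∉ insert a A → g y = c.ct b (swap a b • f (swap a b • y)) := by
  choose S hS using M.exists_supportedBy
  choose b hb using fun y => exists_notMem (S y ∪ insert a A)
  have key : ∀ (T : Finset ℕ) (y : M) (d : ℕ), SupportedBy T y → d ∉ T → d ∉ insert a A →
      c.ct (b y) (swap a (b y) • f (swap a (b y) • y)) = c.ct d (swap a d • f (swap a d • y)) := by
    intro T y d hT hd hdA
    obtain ⟨e, he⟩ := exists_notMem (S y ∪ T ∪ insert a A)
    rw [c.ct_swap_congr hf (hS y) (d := e) (by grind) (by grind) (by grind) (by grind),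
      c.ct_swap_congr hf hT (d := d) (by grind) (by grind) hd hdA]
  refine ⟨{ toFun := fun y => c.ct (b y) (swap a (b y) • f (swap a (b y) • y))
            map_add' := fun y z => ?_
            map_smul' := fun r y => ?_ }, fun σ hσ y => ?_, key⟩
  · obtain ⟨e, he⟩ := exists_notMem (S y ∪ S z ∪ insert a A)
    have hy := (hS y).mono (Finset.subset_union_left (s₂ := S z))
    have hz := (hS z).mono (Finset.subset_union_right (s₁ := S y))
    rw [key _ _ e hy (by grind) (by grind), key _ _ e hz (by grind) (by grind),
      key _ _ e (hy.add hz) (by grind) (by grind)]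
    simp
  · obtain ⟨R, hR⟩ := (isSmooth_ratFun k).exists_supportedBy r
    obtain ⟨e, he⟩ := exists_notMem (R ∪ S y ∪ insert a A)
    have hy := (hS y).mono (Finset.subset_union_right (s₁ := R))
    rw [key _ _ e (hS y) (by grind) (by grind), key _ _ e (supportedBy_smul
      (hR.mono (Finset.subset_union_left (s₂ := S y))) hy) (by grind) (by grind),
      M.semilinear, f.map_smul, Q.semilinear, swap_smul_swap_smul,
      c.ct_smul _ (freeOf_of_supportedBy hR (by grind)), RingHom.id_apply]
  · obtain ⟨e, he⟩ := exists_notMem (S y ∪ insert a A ∪ σ⁻¹ • insert a A)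
    simp only [Finset.mem_union, not_or] at he
    have heσ : σ • e ∉ insert a A := fun h => he.2 (Finset.mem_inv_smul_finset_iff.2 h)
    have h1 := key _ _ e (hS y) he.1.1 he.1.2
    have h2 := key _ _ (σ • e) ((hS y).smul σ) (by simpa using he.1.1) heσ
    change c.ct _ _ = σ • c.ct _ _
    rw [h1, h2, c.smul_ct]
    -- Conjugating at `e` on one side and at `σ • e` on the other replaces `σ` by a permutation that
    -- also fixes `a`, to which the equivariance of `f` applies.
    have hρ : swap a (σ • e) * σ * swap a e ∈ fix (insert a A) := by
      refine mem_fix.2 fun i hi => ?_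
      rw [mul_smul, mul_smul]
      rcases Finset.mem_insert.1 hi with rfl | hi
      · simp
      · have hia : i ≠ a := fun h => ha (h ▸ hi)
        have hie : i ≠ e := fun h => he.1.2 (h ▸ Finset.mem_insert_of_mem hi)
        have hie' : i ≠ σ • e := fun h => heσ (h ▸ Finset.mem_insert_of_mem hi)
        rw [swap_smul_of_ne hia hie, mem_fix.1 hσ i hi, swap_smul_of_ne hia hie']
    have h3 := hf _ hρ (swap a e • y)
    rw [mul_smul, mul_smul, swap_smul_swap_smul, mul_smul, mul_smul] at h3
    rw [h3, swap_smul_swap_smul]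

/-- Average over the letters of `A` one at a time. Where `f` already commutes with everything, its
conjugates have the same value and the constant term in a fresh variable changes nothing. The
condition on `y` is inherited by its translates, so it survives each averaging. -/
theorem exists_equivariant (c : ConstTerms Q) (A : Finset ℕ) (hf : FixEquivariant A f) :
    ∃ g : M →ₗ[RatFun k] Q, FixEquivariant ∅ g ∧
      ∀ y, (∀ τ : infSymm, f (τ • y) = τ • f y) → g y = f y := by
  induction A using Finset.induction_on generalizing f with
  | empty => exact ⟨f, hf, fun _ _ => rfl⟩
  | insert a A ha ih =>
    obtain ⟨g, hg, hgf⟩ := c.exists_average ha hf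
    have h1 : ∀ y, (∀ τ : infSymm, f (τ • y) = τ • f y) → g y = f y := by
      intro y hy
      obtain ⟨S, hS⟩ := M.exists_supportedBy y
      obtain ⟨b, hb⟩ := exists_notMem (S ∪ insert a A)
      rw [hgf S y b hS (by grind) (by grind), hy, swap_smul_swap_smul]
      refine c.ct_of_notMem (S := S) (fun σ hσ => ?_) (by grind)
      rw [← hy, hS σ hσ]
    obtain ⟨g', hg', h2⟩ := ih hg
    refine ⟨g', hg', fun y hy => ?_⟩
    rw [h2 y fun τ => ?_, h1 y hy]
    rw [h1 y hy, h1 (τ • y) fun ρ => ?_, hy]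
    rw [smul_smul, hy, hy, smul_smul]

end ConstTerms

/-- Averaging may destroy `f`, so `f` is first multiplied by an `h` in `ξ_a` alone for which the
coordinate at `T` has non-zero constant term in `ξ_a`. As `y` involves neither `a` nor `b`, the
average at `y` is a translate of the constant term of `h • f y`, and its coordinate at `T` stays
non-zero. -/
theorem exists_equivariant_ne_zero {M : SmoothSemilinRep k} {r : ℕ} (A : Finset ℕ)
    {f : M →ₗ[RatFun k] I k r} (hf : FixEquivariant A f) {S : Finset ℕ} {y : M}
    (hy : SupportedBy S y) (hSA : Disjoint S A) {T : Set.powersetCard ℕ r}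
    (hT : Disjoint (T : Finset ℕ) A) (h0 : (basisI k r).repr (f y) T ≠ 0) :
    ∃ g : M →ₗ[RatFun k] I k r, FixEquivariant ∅ g ∧ g ≠ 0 := by
  induction A using Finset.induction_on generalizing f with
  | empty => exact ⟨f, hf, fun h => h0 (by simp [h])⟩
  | insert a A ha ih =>
    obtain ⟨h, ha', hh⟩ := exists_constTerm_mul_ne_zero a h0
    have hf1 : FixEquivariant (insert a A) (h • f) := fun σ hσ x => by
      rw [LinearMap.smul_apply, LinearMap.smul_apply, (I k r).semilinear, hf σ hσ,
        ha' σ (fix_anti (by simp) hσ)]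
    obtain ⟨g, hg, hgf⟩ := (constTermsI k r).exists_average ha hf1
    rw [Finset.disjoint_insert_right] at hSA hT
    refine ih hg hSA.2 hT.2 ?_
    obtain ⟨b, hb⟩ := exists_notMem (S ∪ insert a A ∪ T)
    simp only [Finset.mem_union, not_or] at hb
    have h1 := hgf S y b hy hb.1.1 hb.1.2
    have h2 := (constTermsI k r).smul_ct (swap a b) a ((h • f) y)
    have h3 := repr_smul (swap a b) ((constTermsI k r).ct a ((h • f) y)) T
    rw [swap_smul_left] at h2
    rw [hy _ (swap_mem_fix hSA.1 hb.1.1), ← h2] at h1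
    have h4 : swap a b • T = T := Subtype.ext
      (smul_finset_of_mem_fix (swap_mem_fix hT.1 hb.2) subset_rfl)
    rw [h4, ← h1] at h3
    rw [h3, Ne, smul_eq_zero_iff_eq]
    change (basisI k r).repr (ctI k r a ((h • f) y)) T ≠ 0
    rwa [repr_ctI_of_notMem hT.1, LinearMap.smul_apply, map_smul, Finsupp.smul_apply, smul_eq_mul]

end SmoothSemilinRep
namespace SmoothSemilinRep

open SemilinRep

variable {k : Type u} [Field k]

/-! ### Equivariant families of vectors -/

/-- A submodule is stable under the permutations that fix each letter of `A`. -/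
def Stable {M : SmoothSemilinRep k} (A : Finset ℕ) (N : Submodule (RatFun k) M) : Prop :=
  ∀ σ ∈ fix A, ∀ x ∈ N, σ • x ∈ N

theorem Stable.mono {M : SmoothSemilinRep k} {A B : Finset ℕ} {N : Submodule (RatFun k) M}
    (h : Stable A N) (hAB : A ⊆ B) : Stable B N := fun σ hσ => h σ (fix_anti hAB hσ)

theorem Stable.sup {M : SmoothSemilinRep k} {A : Finset ℕ} {N P : Submodule (RatFun k) M}
    (hN : Stable A N) (hP : Stable A P) : Stable A (N ⊔ P) := by
  intro σ hσ x hx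
  obtain ⟨y, hy, z, hz, rfl⟩ := Submodule.mem_sup.1 hx
  rw [smul_add]
  exact Submodule.add_mem_sup (hN σ hσ y hy) (hP σ hσ z hz)

theorem stable_span {M : SmoothSemilinRep k} {A : Finset ℕ} {s : Set M}
    (h : ∀ σ ∈ fix A, ∀ x ∈ s, σ • x ∈ Submodule.span (RatFun k) s) :
    Stable A (Submodule.span (RatFun k) s) := by
  intro σ hσ x hx
  induction hx using Submodule.span_induction with
  | mem x hx => exact h σ hσ x hx
  | zero => rw [smul_zero]; exact zero_mem _
  | add x y _ _ hx hy => rw [smul_add]; exact add_mem hx hy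
  | smul a x _ hx => rw [M.semilinear]; exact Submodule.smul_mem _ _ hx

/-- Finitely many families of vectors `e i T`, where `T` runs over the sets of `r i` letters
outside of the finite set `base`; they are permuted by the permutations that fix `base`. -/
structure Fam (M : SmoothSemilinRep k) where
  base : Finset ℕ
  ι : Type
  [finite : Finite ι]
  r : ι → ℕ
  e : ι → Finset ℕ → M
  smul_e : ∀ i, ∀ σ ∈ fix base, ∀ T : Finset ℕ, T.card = r i → Disjoint T base →
    σ • e i T = e i (σ • T)

namespace Fam

attribute [instance] Fam.finite

variable {M : SmoothSemilinRep k} (F : Fam M)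

/-- The indices of the vectors in a family. -/
def Idx : Type := {p : F.ι × Finset ℕ // p.2.card = F.r p.1 ∧ Disjoint p.2 F.base}

/-- The vectors in a family. -/
def vec (p : F.Idx) : M := F.e p.1.1 p.1.2

/-- The subspace spanned by a family. -/
def span : Submodule (RatFun k) M := Submodule.span (RatFun k) (Set.range F.vec)

variable {F} in
theorem e_mem_span {i : F.ι} {T : Finset ℕ} (hc : T.card = F.r i) (hT : Disjoint T F.base) :
    F.e i T ∈ F.span := Submodule.subset_span ⟨⟨(i, T), hc, hT⟩, rfl⟩

variable {F} in
theorem span_le {N : Submodule (RatFun k) M}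
    (h : ∀ i T, T.card = F.r i → Disjoint T F.base → F.e i T ∈ N) : F.span ≤ N := by
  refine Submodule.span_le.2 ?_
  rintro _ ⟨⟨⟨i, T⟩, hc, hT⟩, rfl⟩
  exact h i T hc hT

theorem stable_span : Stable F.base F.span := by
  refine SmoothSemilinRep.stable_span fun σ hσ x hx => ?_
  obtain ⟨⟨⟨i, T⟩, hc, hT⟩, rfl⟩ := hx
  change σ • F.e i T ∈ F.span
  rw [F.smul_e i σ hσ T hc hT]
  exact e_mem_span (by simpa using hc) (disjoint_smul hσ hT)

/-- A family, viewed over a larger base. -/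
def shift (B : Finset ℕ) (h : F.base ⊆ B) : Fam M where
  base := B
  ι := {p : F.ι × Finset ℕ // p.2 ⊆ B ∧ Disjoint p.2 F.base ∧ p.2.card ≤ F.r p.1}
  finite := Finite.of_injective (β := F.ι × B.powerset)
    (fun p => (p.1.1, ⟨p.1.2, Finset.mem_powerset.2 p.2.1⟩)) fun p q hpq => by
      simp only [Prod.mk.injEq, Subtype.mk.injEq] at hpq
      exact Subtype.ext (Prod.ext hpq.1 hpq.2)
  r p := F.r p.1.1 - p.1.2.card
  e p T := F.e p.1.1 (p.1.2 ∪ T)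
  smul_e p σ hσ T hc hT := by
    obtain ⟨⟨i, V⟩, hV, hd, hle⟩ := p
    have hVT : Disjoint V T := (hT.mono_right hV).symm
    rw [F.smul_e i σ (fix_anti h hσ) (V ∪ T) (by rw [Finset.card_union_of_disjoint hVT]; grind)
      (Finset.disjoint_union_left.2 ⟨hd, hT.mono_right h⟩), Finset.smul_finset_union,
      smul_finset_of_mem_fix hσ hV]

/-- The vectors of a family over a larger base are the same. -/
def shiftIdx (B : Finset ℕ) (h : F.base ⊆ B) : (F.shift B h).Idx ≃ F.Idx where
  toFun p := ⟨(p.1.1.1.1, p.1.1.1.2 ∪ p.1.2), by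
    obtain ⟨⟨⟨⟨i, V⟩, hV, hd, hle⟩, T⟩, hc, hT⟩ := p
    have hVT : Disjoint V T := (hT.mono_right hV).symm
    refine ⟨?_, Finset.disjoint_union_left.2 ⟨hd, hT.mono_right h⟩⟩
    change (V ∪ T).card = F.r i
    change T.card = F.r i - V.card at hc
    change V.card ≤ F.r i at hle
    rw [Finset.card_union_of_disjoint hVT]
    omega⟩
  invFun q := ⟨(⟨(q.1.1, q.1.2 ∩ B), Finset.inter_subset_right,
      q.2.2.mono_left Finset.inter_subset_left,
      (Finset.card_le_card Finset.inter_subset_left).trans q.2.1.le⟩, q.1.2 \ B), by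
    refine ⟨?_, Finset.sdiff_disjoint⟩
    change (q.1.2 \ B).card = F.r q.1.1 - (q.1.2 ∩ B).card
    rw [← q.2.1, ← Finset.card_sdiff_add_card_inter q.1.2 B]
    omega⟩
  left_inv p := by
    obtain ⟨⟨⟨⟨i, V⟩, hV, hd, hle⟩, T⟩, hc, hT⟩ := p
    have hT' : Disjoint T B := hT
    have h1 : (V ∪ T) ∩ B = V := by
      rw [Finset.union_inter_distrib_right, Finset.disjoint_iff_inter_eq_empty.1 hT',
        Finset.union_empty, Finset.inter_eq_left.2 hV]
    have h2 : (V ∪ T) \ B = T := by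
      rw [Finset.union_sdiff_distrib, Finset.sdiff_eq_empty_iff_subset.2 hV,
        Finset.empty_union, Finset.sdiff_eq_self_of_disjoint hT']
    exact Subtype.ext (Prod.ext (Subtype.ext (Prod.ext rfl h1)) h2)
  right_inv q := Subtype.ext (Prod.ext rfl (by
    change q.1.2 ∩ B ∪ q.1.2 \ B = q.1.2
    rw [Finset.union_comm, Finset.sdiff_union_inter]))

theorem vec_comp_shiftIdx (B : Finset ℕ) (h : F.base ⊆ B) :
    F.vec ∘ F.shiftIdx B h = (F.shift B h).vec := rfl

theorem span_shift (B : Finset ℕ) (h : F.base ⊆ B) : (F.shift B h).span = F.span := by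
  rw [span, ← vec_comp_shiftIdx, EquivLike.range_comp]
  rfl

/-- The subfamily given by some of the indices. -/
def restrict (P : F.ι → Prop) : Fam M where
  base := F.base
  ι := {i // P i}
  r i := F.r i.1
  e i := F.e i.1
  smul_e i := F.smul_e i.1

variable {F} in
theorem e_mem_span_restrict {P : F.ι → Prop} {i : F.ι} (hi : P i) {T : Finset ℕ}
    (hc : T.card = F.r i) (hT : Disjoint T F.base) : F.e i T ∈ (F.restrict P).span :=
  e_mem_span (F := F.restrict P) (i := ⟨i, hi⟩) hc hT

theorem span_restrict_le (P : F.ι → Prop) : (F.restrict P).span ≤ F.span :=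
  span_le fun i _ hc hT => e_mem_span (F := F) (i := i.1) hc hT

/-- The union of two families over the same base. -/
def sum (G : Fam M) (h : F.base = G.base) : Fam M where
  base := F.base
  ι := F.ι ⊕ G.ι
  r := Sum.elim F.r G.r
  e := Sum.elim F.e G.e
  smul_e i := by
    cases i with
    | inl i => exact F.smul_e i
    | inr i => rw [h]; exact G.smul_e i

/-- The vectors in the union of two families, as a map. -/
def sumIdxFun (G : Fam M) (h : F.base = G.base) : F.Idx ⊕ G.Idx → (F.sum G h).Idx :=
  Sum.elim (fun p => ⟨(Sum.inl p.1.1, p.1.2), p.2⟩)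
    fun p => ⟨(Sum.inr p.1.1, p.1.2), p.2.1, (congrArg (Disjoint p.1.2) h).mpr p.2.2⟩

theorem sumIdxFun_bijective (G : Fam M) (h : F.base = G.base) :
    Function.Bijective (F.sumIdxFun G h) := by
  constructor
  · rintro (⟨⟨i, T⟩, hp⟩ | ⟨⟨i, T⟩, hp⟩) (⟨⟨j, U⟩, hq⟩ | ⟨⟨j, U⟩, hq⟩) h' <;>
      have h1 := congrArg (fun x => x.1.1) h' <;> have h2 := congrArg (fun x => x.1.2) h'
    · exact congrArg Sum.inl (Subtype.ext (Prod.ext (Sum.inl_injective h1) h2))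
    · exact absurd h1 Sum.inl_ne_inr
    · exact absurd h1 Sum.inr_ne_inl
    · exact congrArg Sum.inr (Subtype.ext (Prod.ext (Sum.inr_injective h1) h2))
  · rintro ⟨⟨i | i, T⟩, hc, hT⟩
    · exact ⟨Sum.inl ⟨(i, T), hc, hT⟩, rfl⟩
    · exact ⟨Sum.inr ⟨(i, T), hc, (congrArg (Disjoint T) h).mp hT⟩, rfl⟩

/-- The vectors in the union of two families. -/
def sumIdx (G : Fam M) (h : F.base = G.base) : F.Idx ⊕ G.Idx ≃ (F.sum G h).Idx :=
  Equiv.ofBijective _ (F.sumIdxFun_bijective G h)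

theorem vec_comp_sumIdx (G : Fam M) (h : F.base = G.base) :
    (F.sum G h).vec ∘ F.sumIdx G h = Sum.elim F.vec G.vec := by
  funext p
  cases p <;> rfl

theorem span_sum (G : Fam M) (h : F.base = G.base) : (F.sum G h).span = F.span ⊔ G.span := by
  rw [span, ← EquivLike.range_comp (F.sum G h).vec (F.sumIdx G h), vec_comp_sumIdx,
    Set.Sum.elim_range, Submodule.span_union]
  rfl

end Fam

theorem linearIndependent_mkQ_sumElim {R V α β : Type*} [Field R] [AddCommGroup V] [Module R V]
    {N : Submodule R V} {v : α → V} {w : β → V} (hw : LinearIndependent R (N.mkQ ∘ w))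
    (hv : LinearIndependent R ((N ⊔ Submodule.span R (Set.range w)).mkQ ∘ v)) :
    LinearIndependent R (N.mkQ ∘ Sum.elim v w) := by
  let f : (V ⧸ N) →ₗ[R] V ⧸ (N ⊔ Submodule.span R (Set.range w)) := Submodule.factor le_sup_left
  have hv' : LinearIndependent R (f ∘ (N.mkQ ∘ v)) := hv
  have hwf : ∀ i, f (N.mkQ (w i)) = 0 := fun i =>
    (Submodule.Quotient.mk_eq_zero _).2 (Submodule.mem_sup_right (Submodule.subset_span ⟨i, rfl⟩))
  rw [Sum.comp_elim]
  refine LinearIndependent.sum_type (LinearIndependent.of_comp f hv') hw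
    ((Submodule.range_ker_disjoint hv').mono_right (Submodule.span_le.2 ?_))
  rintro _ ⟨i, rfl⟩
  exact hwf i

/-! ### Linear independence of families modulo a subobject. -/

namespace Fam

variable {M : SmoothSemilinRep k}

theorem linearIndependent_shift {F : Fam M} {N : Submodule (RatFun k) M}
    (hF : LinearIndependent (RatFun k) (N.mkQ ∘ F.vec)) (B : Finset ℕ) (h : F.base ⊆ B) :
    LinearIndependent (RatFun k) (N.mkQ ∘ (F.shift B h).vec) := by
  rw [← vec_comp_shiftIdx, ← Function.comp_assoc]
  exact hF.comp _ (F.shiftIdx B h).injective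

theorem linearIndependent_sum {F G : Fam M} (h : F.base = G.base) {N : Submodule (RatFun k) M}
    (hG : LinearIndependent (RatFun k) (N.mkQ ∘ G.vec))
    (hF : LinearIndependent (RatFun k) ((N ⊔ G.span).mkQ ∘ F.vec)) :
    LinearIndependent (RatFun k) (N.mkQ ∘ (F.sum G h).vec) := by
  have h1 := linearIndependent_mkQ_sumElim hG hF
  rw [← vec_comp_sumIdx F G h, ← Function.comp_assoc] at h1
  exact (linearIndependent_equiv (F.sumIdx G h)).1 h1

/-- The finite set `s` is recorded because its letters will be absorbed into a larger base. -/
theorem exists_mem_sup_span_of_not_linearIndependent {R V α : Type*} [Field R] [AddCommGroup V]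
    [Module R V] {L : Submodule R V} {v : α → V} (h : ¬ LinearIndependent R (L.mkQ ∘ v)) :
    ∃ (s : Finset α) (p : α), v p ∈ L ⊔ Submodule.span R (v '' {q | q ∈ s ∧ q ≠ p}) := by
  classical
  rw [linearIndependent_iff'] at h
  push Not at h
  obtain ⟨s, g, hg, p, hp, hgp⟩ := h
  refine ⟨s, p, ?_⟩
  have hmem : ∑ i ∈ s, g i • v i ∈ L := by
    rw [← Submodule.Quotient.mk_eq_zero, ← Submodule.mkQ_apply, map_sum]
    simpa using hg
  rw [← Finset.add_sum_erase s _ hp] at hmem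
  have h2 : ∑ i ∈ s.erase p, g i • v i ∈ Submodule.span R (v '' {q | q ∈ s ∧ q ≠ p}) := by
    refine Submodule.sum_mem _ fun i hi =>
      Submodule.smul_mem _ _ (Submodule.subset_span ⟨i, ?_, rfl⟩)
    rw [Finset.mem_erase] at hi
    exact ⟨hi.2, hi.1⟩
  have h3 : g p • v p ∈ L ⊔ Submodule.span R (v '' {q | q ∈ s ∧ q ≠ p}) := by
    have := Submodule.sub_mem _ (Submodule.mem_sup_left (T := Submodule.span R
      (v '' {q | q ∈ s ∧ q ≠ p})) hmem) (Submodule.mem_sup_right (S := L) h2)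
    simpa using this
  have := Submodule.smul_mem _ (g p)⁻¹ h3
  rwa [inv_smul_smul₀ hgp] at this

/-- If one of the vectors of the largest size is redundant, then, over a larger base, the family can
be replaced by a family with fewer vectors of that size. -/
theorem exists_fewer (F : Fam M) {D : ℕ} (hD : ∀ i, F.r i ≤ D) {N : Submodule (RatFun k) M}
    (hN : Stable ∅ N)
    (h : ¬ LinearIndependent (RatFun k)
      ((N ⊔ (F.restrict fun i => F.r i < D).span).mkQ ∘ (F.restrict fun i => F.r i = D).vec)) :
    ∃ G : Fam M, F.base ⊆ G.base ∧ N ⊔ G.span = N ⊔ F.span ∧ (∀ i, G.r i ≤ D) ∧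
      Nat.card {i // G.r i = D} < Nat.card {i // F.r i = D} := by
  obtain ⟨s, ⟨⟨⟨i₀, hi₀⟩, T₀⟩, hc₀, hT₀⟩, hp⟩ := exists_mem_sup_span_of_not_linearIndependent h
  change T₀.card = F.r i₀ at hc₀
  change Disjoint T₀ F.base at hT₀
  -- This base avoids `T₀`, yet it meets every other set of the size of `T₀` in the relation. Over
  -- `B`, the redundant vector therefore belongs to the family `j₀` and no other term of the
  -- relation does.
  let B : Finset ℕ := F.base ∪ s.biUnion fun q => q.1.2 \ T₀
  have hB : F.base ⊆ B := Finset.subset_union_left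
  have hT₀B : Disjoint T₀ B := by
    refine Finset.disjoint_union_right.2 ⟨hT₀, ?_⟩
    rw [Finset.disjoint_biUnion_right]
    exact fun q _ => Finset.disjoint_sdiff
  let j₀ : (F.shift B hB).ι := ⟨(i₀, ∅), by simp⟩
  let G := (F.shift B hB).restrict (· ≠ j₀)
  have hG : ∀ i T, T.card = F.r i → Disjoint T F.base → (i = i₀ → T ∩ B ≠ ∅) →
      F.e i T ∈ G.span := by
    intro i T hc hT hne
    obtain ⟨q, hq⟩ := (F.shiftIdx B hB).surjective ⟨(i, T), hc, hT⟩
    have hqv : (F.shift B hB).vec q = F.e i T := by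
      rw [← vec_comp_shiftIdx, Function.comp_apply, hq]
      rfl
    rw [← hqv]
    refine e_mem_span_restrict (F := F.shift B hB) ?_ q.2.1 q.2.2
    intro hj
    have h1 : q = (F.shiftIdx B hB).symm ⟨(i, T), hc, hT⟩ := by rw [← hq, Equiv.symm_apply_apply]
    have h2 : q.1.1.1 = (i, T ∩ B) := by rw [h1]; rfl
    rw [hj] at h2
    have h3 : i₀ = i := congrArg Prod.fst h2
    have h4 : ∅ = T ∩ B := congrArg Prod.snd h2
    exact hne h3.symm h4.symm
  have hvec : F.e i₀ T₀ ∈ N ⊔ G.span := by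
    refine (sup_le (sup_le le_sup_left ?_) ?_ :
      (N ⊔ (F.restrict fun i => F.r i < D).span) ⊔ Submodule.span (RatFun k)
        ((F.restrict fun i => F.r i = D).vec '' _) ≤ N ⊔ G.span) hp
    · refine le_trans ?_ le_sup_right
      refine span_le fun i T hc hT => hG i.1 T hc hT ?_
      rintro hi
      exact absurd (hi ▸ i.2) (by omega)
    · refine le_trans (Submodule.span_le.2 ?_) le_sup_right
      rintro _ ⟨⟨⟨⟨i, hi⟩, T⟩, hc, hT⟩, ⟨hqs, hqp⟩, rfl⟩
      change T.card = F.r i at hc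
      refine hG i T hc hT ?_
      rintro rfl hTB
      refine hqp (Subtype.ext (Prod.ext rfl ?_))
      refine Finset.eq_of_subset_of_card_le ?_ (by change T₀.card ≤ T.card; omega)
      intro x hx
      by_contra hxT
      have : x ∈ T ∩ B := Finset.mem_inter.2 ⟨hx, Finset.mem_union_right _
        (Finset.mem_biUnion.2 ⟨_, hqs, Finset.mem_sdiff.2 ⟨hx, hxT⟩⟩)⟩
      rw [hTB] at this
      exact Finset.notMem_empty _ this
  have hle : F.span ≤ N ⊔ G.span := by
    refine span_le fun i T hc hT => ?_
    by_cases h1 : i = i₀ ∧ T ∩ B = ∅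
    · obtain ⟨rfl, hTB⟩ := h1
      -- Translates under `fix B` of the one redundant vector exhaust the family `j₀`, so the whole
      -- family is redundant.
      obtain ⟨σ, hσ, hσT⟩ := exists_smul_eq (hc₀.trans hc.symm) hT₀B
        (Finset.disjoint_iff_inter_eq_empty.2 hTB)
      rw [← hσT, ← F.smul_e i σ (fix_anti hB hσ) T₀ hc₀ hT₀]
      exact (hN.mono (Finset.empty_subset _)).sup G.stable_span σ hσ _ hvec
    · exact Submodule.mem_sup_right (hG i T hc hT fun hi hTB => h1 ⟨hi, hTB⟩)
  -- Over `B` a family splits according to the part of its sets inside `B`, and only the empty part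
  -- keeps the size. So each family of size `D` yields one of size `D`, and the one from `i₀` has
  -- been dropped.
  have hGr : ∀ j : G.ι, G.r j = D → j.1.1.2 = ∅ ∧ F.r j.1.1.1 = D := by
    rintro ⟨⟨⟨i, V⟩, hV, hd, hcV⟩, hj⟩ h1
    change F.r i - V.card = D at h1
    change V.card ≤ F.r i at hcV
    have := hD i
    change V = ∅ ∧ F.r i = D
    rw [← Finset.card_eq_zero]
    omega
  refine ⟨G, hB, le_antisymm (sup_le le_sup_left ?_) (sup_le le_sup_left hle), fun j => ?_, ?_⟩
  · refine le_trans (span_restrict_le _ _) ?_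
    rw [span_shift]
    exact le_sup_right
  · exact (Nat.sub_le _ _).trans (hD j.1.1.1)
  · let f : {j // G.r j = D} → {i // F.r i = D} := fun j => ⟨j.1.1.1.1, (hGr j.1 j.2).2⟩
    have hf : Function.Injective f := by
      rintro ⟨j, hj⟩ ⟨j', hj'⟩ h1
      have h2 : j.1.1.1 = j'.1.1.1 := congrArg Subtype.val h1
      exact Subtype.ext (Subtype.ext (Subtype.ext (Prod.ext h2
        ((hGr j hj).1.trans (hGr j' hj').1.symm))))
    have hf' : (⟨i₀, hi₀⟩ : {i // F.r i = D}) ∉ Set.range f := by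
      rintro ⟨⟨j, hj⟩, h1⟩
      have h2 : j.1.1.1 = i₀ := congrArg Subtype.val h1
      exact j.2 (Subtype.ext (Prod.ext h2 (hGr j hj).1))
    have := Fintype.ofFinite {j // G.r j = D}
    have := Fintype.ofFinite {i // F.r i = D}
    rw [Nat.card_eq_fintype_card, Nat.card_eq_fintype_card]
    exact Fintype.card_lt_of_injective_of_notMem f hf hf'

theorem span_restrict_sup (F : Fam M) {D : ℕ} (hD : ∀ i, F.r i ≤ D) :
    (F.restrict fun i => F.r i = D).span ⊔ (F.restrict fun i => F.r i < D).span = F.span := by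
  refine le_antisymm (sup_le (span_restrict_le _ _) (span_restrict_le _ _))
    (span_le fun i T hc hT => ?_)
  rcases (hD i).lt_or_eq with h | h
  · exact Submodule.mem_sup_right
      (e_mem_span_restrict (F := F) (P := fun i => F.r i < D) h hc hT)
  · exact Submodule.mem_sup_left
      (e_mem_span_restrict (F := F) (P := fun i => F.r i = D) h hc hT)

/-- Over a larger base, every family can be made linearly independent modulo a subobject. -/
theorem exists_linearIndependent {N : Submodule (RatFun k) M} (hN : Stable ∅ N) (D : ℕ)
    (F : Fam M) (hD : ∀ i, F.r i < D) :
    ∃ G : Fam M, F.base ⊆ G.base ∧ N ⊔ G.span = N ⊔ F.span ∧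
      LinearIndependent (RatFun k) (N.mkQ ∘ G.vec) := by
  induction D generalizing F with
  | zero =>
    have : IsEmpty F.Idx := ⟨fun p => absurd (hD p.1.1) (Nat.not_lt_zero _)⟩
    exact ⟨F, subset_rfl, rfl, linearIndependent_empty_type⟩
  | succ D ihD =>
    -- Lexicographic induction: on the bound for the sizes, then on the number of families of the
    -- largest size. Passing to a larger base may create many families, but only of smaller size.
    induction hn : Nat.card {i // F.r i = D} using Nat.strong_induction_on generalizing F with
    | _ n ih =>
    have hD' : ∀ i, F.r i ≤ D := fun i => Nat.lt_succ_iff.1 (hD i)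
    by_cases h : LinearIndependent (RatFun k)
      ((N ⊔ (F.restrict fun i => F.r i < D).span).mkQ ∘ (F.restrict fun i => F.r i = D).vec)
    -- The smaller families are replaced over a larger base without changing their span modulo `N`,
    -- so the largest ones, moved to that base, remain independent modulo it.
    · obtain ⟨G, hB', hspan, hG⟩ := ihD (F.restrict fun i => F.r i < D) fun i => i.2
      have hB : (F.restrict fun i => F.r i = D).base ⊆ G.base := hB'
      have hb : ((F.restrict fun i => F.r i = D).shift G.base hB).base = G.base := rfl
      refine ⟨((F.restrict fun i => F.r i = D).shift G.base hB).sum G hb, hB, ?_,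
        linearIndependent_sum _ hG ?_⟩
      · rw [span_sum, span_shift, ← F.span_restrict_sup hD', sup_left_comm, hspan, sup_left_comm]
      · rw [hspan]
        exact linearIndependent_shift h _ _
    · obtain ⟨G, hB, hspan, hr, hlt⟩ := F.exists_fewer hD' hN h
      obtain ⟨G', hB', hspan', hG'⟩ :=
        ih _ (hn ▸ hlt) G (fun i => Nat.lt_succ_iff.2 (hr i)) rfl
      exact ⟨G', hB.trans hB', hspan'.trans hspan, hG'⟩

end Fam

end SmoothSemilinRep
namespace SmoothSemilinRep

open SemilinRep

variable {k : Type u} [Field k]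

/-! ### Vectors stabilized by the permutations that preserve a finite set -/

/-- A permutation of a finite set of letters, as an element of the infinite symmetric group. -/
def permEmb (S : Finset ℕ) : Equiv.Perm S →* infSymm where
  toFun π := ⟨Equiv.Perm.ofSubtype π, S.sup id + 1, fun i hi =>
    Equiv.Perm.ofSubtype_apply_of_not_mem π fun h => by
      have : i ≤ S.sup id := Finset.le_sup (f := id) h
      omega⟩
  map_one' := Subtype.ext (map_one _)
  map_mul' _ _ := Subtype.ext (map_mul _ _ _)

theorem permEmb_smul {S : Finset ℕ} (π : Equiv.Perm S) (i : S) : permEmb S π • (i : ℕ) = π i :=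
  Equiv.Perm.ofSubtype_apply_coe π i

/-- A permutation that preserves `S` acts on the vectors supported by `S` through its
restriction to `S`. -/
theorem exists_perm_of_smul_eq {S : Finset ℕ} {σ : infSymm} (hσ : σ • S = S) :
    ∃ ρ : Equiv.Perm S, ∀ π : Equiv.Perm S,
      (permEmb S (ρ * π))⁻¹ * (σ * permEmb S π) ∈ fix S := by
  have hm : ∀ i : ℕ, i ∈ S ↔ (σ : Equiv.Perm ℕ) i ∈ S := fun i => by
    conv_rhs => rw [← hσ]
    exact (Finset.smul_mem_smul_finset_iff σ).symm
  refine ⟨(σ : Equiv.Perm ℕ).subtypePerm fun i => (hm i).symm, fun π => mem_fix.2 fun i hi => ?_⟩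
  have h1 := permEmb_smul π ⟨i, hi⟩
  change permEmb S π • i = _ at h1
  rw [mul_smul, mul_smul, inv_smul_eq_iff, h1, map_mul, mul_smul, h1, permEmb_smul]
  rfl

/-- Independence of characters, in the form of a spanning statement. -/
theorem span_perm_eq_top (S : Finset ℕ) :
    Submodule.span (RatFun k) {v : Equiv.Perm S → RatFun k | ∃ c, SupportedBy S c ∧
      v = fun π => permEmb S π • c} = ⊤ := by
  by_contra hne
  obtain ⟨f, hf0, hf⟩ := Submodule.exists_le_ker_of_lt_top _ (lt_top_iff_ne_top.2 hne)
  -- A functional killing the span is a linear relation between the maps `c ↦ π • c` on the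
  -- multiplicative monoid `C`. These are distinct characters, as the variables `ξ_i` with `i ∈ S`
  -- separate the `π`, so Dedekind's theorem applies.
  let C : Submonoid (RatFun k) :=
    { carrier := {c | SupportedBy S c}
      one_mem' := fun σ _ => smul_one σ
      mul_mem' := fun {a b} ha hb σ hσ => by rw [smul_mul', ha σ hσ, hb σ hσ] }
  let χ : Equiv.Perm S → (C →* RatFun k) := fun π =>
    (MulDistribMulAction.toMonoidHom (RatFun k) (permEmb S π)).comp C.subtype
  have hχ : Function.Injective χ := by
    intro π ρ h
    ext i
    have h1 := DFunLike.congr_fun h ⟨xi k i, fun σ hσ => by rw [smul_xi, mem_fix.1 hσ i i.2]⟩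
    change permEmb S π • xi k i = permEmb S ρ • xi k i at h1
    rw [smul_xi, smul_xi, permEmb_smul, permEmb_smul] at h1
    exact xi_injective h1
  have hli := (linearIndependent_monoidHom C (RatFun k)).comp χ hχ
  rw [Fintype.linearIndependent_iff] at hli
  have h0 := hli (fun π => f (Pi.single π 1)) (by
    funext c
    have h1 : f (fun π => permEmb S π • (c : RatFun k)) = 0 :=
      hf (Submodule.subset_span ⟨c, c.2, rfl⟩)
    rw [LinearMap.pi_apply_eq_sum_univ] at h1
    rw [Finset.sum_apply, Pi.zero_apply, ← h1]
    refine Finset.sum_congr rfl fun π _ => ?_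
    change f (Pi.single π 1) * (permEmb S π • (c : RatFun k)) = _
    rw [mul_comm, smul_eq_mul]
    congr 2
    funext ρ
    simp [Pi.single_apply, eq_comm])
  refine hf0 (LinearMap.pi_ext' fun π => LinearMap.ext_ring ?_)
  simpa using h0 π

/-- The subobject generated by a vector. -/
def cyc {M : SmoothSemilinRep k} (x : M) : Submodule (RatFun k) M :=
  Submodule.span (RatFun k) (Set.range fun σ : infSymm => σ • x)

theorem mem_cyc {M : SmoothSemilinRep k} (x : M) : x ∈ cyc x :=
  Submodule.subset_span ⟨1, one_smul _ _⟩

theorem stable_cyc {M : SmoothSemilinRep k} (x : M) : Stable ∅ (cyc x) := by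
  refine stable_span ?_
  rintro σ - _ ⟨τ, rfl⟩
  exact Submodule.subset_span ⟨σ * τ, mul_smul _ _ _⟩

theorem cyc_le {M : SmoothSemilinRep k} {x : M} {N : Submodule (RatFun k) M} (hN : Stable ∅ N)
    (hx : x ∈ N) : cyc x ≤ N := by
  refine Submodule.span_le.2 ?_
  rintro _ ⟨σ, rfl⟩
  exact hN σ (fix_empty σ) x hx

/-- Galois descent: a vector supported by `S` is a combination of vectors stabilized by all
permutations that preserve `S`. -/
theorem mem_span_stabilized {M : SmoothSemilinRep k} {S : Finset ℕ} {x : M}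
    (hx : SupportedBy S x) :
    x ∈ Submodule.span (RatFun k)
      {w : M | (∀ σ : infSymm, σ • S = S → σ • w = w) ∧ w ∈ cyc x} := by
  -- This map sends the vector `(π • c)` to the trace of `c • x` over the permutations of `S`, and
  -- the unit vector at the identity to `x`.
  let Θ : (Equiv.Perm S → RatFun k) →ₗ[RatFun k] M :=
    Fintype.linearCombination (RatFun k) fun π => permEmb S π • x
  have h1 : Pi.single (1 : Equiv.Perm S) (1 : RatFun k) ∈ Submodule.span (RatFun k)
      {v : Equiv.Perm S → RatFun k | ∃ c, SupportedBy S c ∧ v = fun π => permEmb S π • c} := by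
    rw [span_perm_eq_top]
    exact Submodule.mem_top
  have h2 := Submodule.mem_map_of_mem (f := Θ) h1
  have h3 : Θ (Pi.single 1 1) = x := by
    simp [Θ, Fintype.linearCombination_apply_single]
  rw [Submodule.map_span, h3] at h2
  refine Submodule.span_le.2 ?_ h2
  rintro _ ⟨_, ⟨c, hc, rfl⟩, rfl⟩
  refine Submodule.subset_span ⟨fun σ hσ => ?_, ?_⟩
  · have hw : Θ (fun π => permEmb S π • c) = ∑ π : Equiv.Perm S, permEmb S π • (c • x) := by
      rw [Fintype.linearCombination_apply]
      exact Finset.sum_congr rfl fun π _ => (M.semilinear _ _ _).symm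
    obtain ⟨ρ, hρ⟩ := exists_perm_of_smul_eq hσ
    rw [hw, Finset.smul_sum]
    refine Fintype.sum_equiv (Equiv.mulLeft ρ) _ _ fun π => ?_
    have := supportedBy_smul hc hx _ (hρ π)
    rwa [mul_smul, inv_smul_eq_iff, mul_smul] at this
  · rw [Fintype.linearCombination_apply]
    exact Submodule.sum_mem _ fun π _ => Submodule.smul_mem _ _
      (stable_cyc x _ (fix_empty _) _ (mem_cyc x))

/-- By descent `x` is a combination of finitely many `w` in `cyc x` fixed by the setwise stabilizer
of `S`. For such `w` the vector `σ • w` depends only on `σ • S`, so its orbit is a family with empty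
base. -/
theorem exists_fam_span_eq_cyc {M : SmoothSemilinRep k} (x : M) : ∃ F : Fam M, F.span = cyc x := by
  classical
  obtain ⟨S, hS⟩ := M.exists_supportedBy x
  obtain ⟨t, ht, hxt⟩ := Submodule.mem_span_finite_of_mem_span (mem_span_stabilized hS)
  let e : Fin t.card → M := fun i => (t.equivFin.symm i : M)
  have he : ∀ i, (∀ σ : infSymm, σ • S = S → σ • e i = e i) ∧ e i ∈ cyc x :=
    fun i => ht (t.equivFin.symm i).2
  let E : Fin t.card → Finset ℕ → M := fun i T =>
    if h : ∃ σ : infSymm, σ • S = T then h.choose • e i else 0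
  have hE : ∀ i (σ : infSymm), E i (σ • S) = σ • e i := by
    intro i σ
    have h : ∃ τ : infSymm, τ • S = σ • S := ⟨σ, rfl⟩
    have h1 : E i (σ • S) = h.choose • e i := dif_pos h
    rw [h1, ← inv_smul_eq_iff, smul_smul]
    refine (he i).1 _ ?_
    rw [mul_smul, h.choose_spec, inv_smul_smul]
  let F : Fam M :=
    { base := ∅
      ι := Fin t.card
      r := fun _ => S.card
      e := E
      smul_e := fun i σ _ T hT _ => by
        obtain ⟨τ, -, rfl⟩ := exists_smul_eq (A := ∅) hT.symm (by simp) (by simp)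
        rw [hE, smul_smul, smul_smul, hE] }
  refine ⟨F, le_antisymm (Fam.span_le fun i T hT _ => ?_) (cyc_le F.stable_span ?_)⟩
  · obtain ⟨τ, -, rfl⟩ := exists_smul_eq (A := ∅) (show S.card = T.card from hT.symm) (by simp)
      (by simp)
    change E i (τ • S) ∈ _
    rw [hE]
    exact stable_cyc x _ (fix_empty _) _ (he i).2
  · refine Submodule.span_le.2 (fun w hw => ?_) hxt
    have h1 := Fam.e_mem_span (F := F) (i := t.equivFin ⟨w, hw⟩) (T := S) rfl (by simp [F])
    have h2 : F.e (t.equivFin ⟨w, hw⟩) S = w := by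
      have := hE (t.equivFin ⟨w, hw⟩) 1
      rw [one_smul, one_smul] at this
      exact this.trans (by simp [e])
    rwa [h2] at h1

theorem exists_linearIndependent_fam {M : SmoothSemilinRep k} {N : Submodule (RatFun k) M}
    (hN : Stable ∅ N) (x : M) : ∃ G : Fam M, N ⊔ G.span = N ⊔ cyc x ∧
      LinearIndependent (RatFun k) (N.mkQ ∘ G.vec) := by
  obtain ⟨F, hF⟩ := exists_fam_span_eq_cyc x
  obtain ⟨D, hD⟩ : ∃ D, ∀ i, F.r i < D := by
    obtain ⟨D, hD⟩ := (Set.finite_range F.r).bddAbove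
    exact ⟨D + 1, fun i => Nat.lt_succ_iff.2 (hD ⟨i, rfl⟩)⟩
  obtain ⟨G, -, hG, hli⟩ := F.exists_linearIndependent hN D hD
  exact ⟨G, hF ▸ hG, hli⟩

/-- A subobject with a cyclic quotient is a direct summand with respect to an open subgroup. -/
theorem exists_retraction {M : SmoothSemilinRep k} {N : Submodule (RatFun k) M}
    (hN : Stable ∅ N) (x : M) (h : N ⊔ cyc x = ⊤) :
    ∃ (A : Finset ℕ) (ρ : M →ₗ[RatFun k] M), FixEquivariant A ρ ∧ (∀ y, ρ y ∈ N) ∧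
      ∀ y ∈ N, ρ y = y := by
  obtain ⟨G, hG, hli⟩ := exists_linearIndependent_fam hN x
  have hc : IsCompl N G.span := by
    refine ⟨?_, codisjoint_iff.2 (hG.trans h)⟩
    have := Submodule.range_ker_disjoint hli
    rw [Submodule.ker_mkQ] at this
    exact this.symm
  refine ⟨G.base, N.projection G.span hc, fun σ hσ y => ?_, Submodule.projection_apply_mem hc,
    fun y hy => Submodule.projection_apply_of_mem_left hc hy⟩
  -- Both summands are stable under `fix G.base`, so the projection commutes with it.
  obtain ⟨n, hn, g, hg, rfl⟩ := Submodule.mem_sup.1 (show y ∈ N ⊔ G.span by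
    rw [hc.sup_eq_top]; exact Submodule.mem_top)
  rw [smul_add, map_add, map_add, Submodule.projection_apply_of_mem_left hc hn,
    Submodule.projection_apply_of_mem_right hc hg, add_zero,
    Submodule.projection_apply_of_mem_left hc (hN σ (fix_empty σ) n hn),
    Submodule.projection_apply_of_mem_right hc (G.stable_span σ hσ g hg), add_zero]

end SmoothSemilinRep
namespace SmoothSemilinRep

open SemilinRep

variable {k : Type u} [Field k]

/-! ### Injectivity of the standard objects -/

/-- A stable submodule, as an object. -/
def sub (M : SmoothSemilinRep k) (N : Submodule (RatFun k) M) (hN : Stable ∅ N) :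
    SmoothSemilinRep k where
  carrier := N
  action :=
    { smul σ x := ⟨σ • (x : M), hN σ (fix_empty σ) x x.2⟩
      one_smul x := Subtype.ext (one_smul _ _)
      mul_smul σ τ x := Subtype.ext (mul_smul _ _ _)
      smul_zero σ := Subtype.ext (smul_zero σ)
      smul_add σ x y := Subtype.ext (smul_add _ _ _) }
  semilinear σ a x := Subtype.ext (M.semilinear σ a x)
  smooth x := by
    obtain ⟨n, hn⟩ := M.smooth (x : M)
    exact ⟨n, fun σ hσ => Subtype.ext (hn σ hσ)⟩

/-- The inclusion of a stable submodule. -/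
def subι (M : SmoothSemilinRep k) (N : Submodule (RatFun k) M) (hN : Stable ∅ N) :
    sub M N hN ⟶ M := ofLin (M := sub M N hN) N.subtype fun _ _ => rfl

/-- An equivariant linear map, as a morphism. -/
def FixEquivariant.hom {M Q : SmoothSemilinRep k} {f : M →ₗ[RatFun k] Q}
    (hf : FixEquivariant ∅ f) : M ⟶ Q := ofLin f fun σ x => hf σ (fix_empty σ) x

theorem stable_ker {M Q : SmoothSemilinRep k} (f : M ⟶ Q) : Stable ∅ (LinearMap.ker (lin f)) :=
  fun σ _ x hx => by
    rw [LinearMap.mem_ker] at hx ⊢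
    rw [lin_smul, hx, smul_zero]

theorem lin_injective_of_mono {M Q : SmoothSemilinRep k} (f : M ⟶ Q) [Mono f] :
    Function.Injective (lin f) := by
  rw [← LinearMap.ker_eq_bot, eq_bot_iff]
  intro x hx
  have h : subι M _ (stable_ker f) ≫ f = 0 ≫ f := by
    ext y
    exact y.2.trans (map_zero (lin f)).symm
  rw [cancel_mono] at h
  exact congrArg (fun g : sub M _ (stable_ker f) ⟶ M => lin g ⟨x, hx⟩) h

theorem mono_of_lin_injective {M Q : SmoothSemilinRep k} (f : M ⟶ Q)
    (hf : Function.Injective (lin f)) : Mono f :=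
  ⟨fun _ _ hgh => hom_ext fun x => hf (congrArg (fun g => lin g x) hgh)⟩

/-- The equivariant linear maps defined on stable subspaces. -/
def EquivariantPMap {M Q : SmoothSemilinRep k} (p : M →ₗ.[RatFun k] Q) : Prop :=
  Stable ∅ p.domain ∧ ∀ (σ : infSymm) (x y : p.domain), (y : M) = σ • (x : M) → p y = σ • p x

theorem equivariantPMap_sSup {M Q : SmoothSemilinRep k} {c : Set (M →ₗ.[RatFun k] Q)}
    (hne : c.Nonempty) (hc : IsChain (· ≤ ·) c) (h : ∀ p ∈ c, EquivariantPMap p) :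
    EquivariantPMap (LinearPMap.sSup c hc.directedOn) := by
  have hmem := fun x => LinearPMap.mem_domain_sSup_iff (x := x) hne hc.directedOn
  refine ⟨fun σ hσ x hx => ?_, ?_⟩
  · obtain ⟨p, hp, hxp⟩ := (hmem x).1 hx
    exact (hmem _).2 ⟨p, hp, (h p hp).1 σ hσ x hxp⟩
  · rintro σ ⟨x, hx⟩ ⟨y, hy⟩ hxy
    obtain ⟨p, hp, hxp⟩ := (hmem x).1 hx
    have hyp : y ∈ p.domain := by
      change y = σ • x at hxy
      exact hxy ▸ (h p hp).1 σ (fix_empty σ) x hxp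
    rw [LinearPMap.sSup_apply hc.directedOn hp ⟨x, hxp⟩,
      LinearPMap.sSup_apply hc.directedOn hp ⟨y, hyp⟩]
    exact (h p hp).2 σ _ _ hxy

/-- An equivariant map on a stable subspace of an object extends to any vector. -/
theorem EquivariantPMap.exists_extension {M Q : SmoothSemilinRep k} (c : ConstTerms Q)
    {p : M →ₗ.[RatFun k] Q} (hp : EquivariantPMap p) (x : M) :
    ∃ q, EquivariantPMap q ∧ p ≤ q ∧ x ∈ q.domain := by
  have hP : Stable ∅ (p.domain ⊔ cyc x) := hp.1.sup (stable_cyc x)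
  let P := sub M _ hP
  let N : Submodule (RatFun k) P := p.domain.comap (p.domain ⊔ cyc x).subtype
  have hN : Stable ∅ N := fun σ hσ y hy => hp.1 σ hσ _ hy
  let x' : P := ⟨x, Submodule.mem_sup_right (mem_cyc x)⟩
  have hcyc : ∀ y (hy : y ∈ cyc x), (⟨y, Submodule.mem_sup_right hy⟩ : P) ∈ cyc x' := by
    intro y hy
    induction hy using Submodule.span_induction with
    | mem y hy =>
      obtain ⟨σ, rfl⟩ := hy
      exact stable_cyc x' σ (fix_empty σ) _ (mem_cyc x')
    | zero => exact zero_mem _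
    | add y z _ _ hy hz => exact add_mem hy hz
    | smul a y _ hy => exact Submodule.smul_mem _ a hy
  have htop : N ⊔ cyc x' = ⊤ := by
    rw [eq_top_iff]
    rintro ⟨y, hy⟩ -
    obtain ⟨n, hn, z, hz, rfl⟩ := Submodule.mem_sup.1 hy
    have hn' : (⟨n, Submodule.mem_sup_left hn⟩ : P) ∈ N := hn
    have h1 := add_mem (Submodule.mem_sup_left (T := cyc x') hn')
      (Submodule.mem_sup_right (S := N) (hcyc z hz))
    exact h1
  obtain ⟨A, ρ, hρ, hρN, hρid⟩ := exists_retraction hN x' htop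
  -- The retraction extends `p` equivariantly for `fix A` only; averaging then gives full
  -- equivariance and keeps the values on the domain of `p`.
  let f : P →ₗ[RatFun k] Q := p.toFun ∘ₗ
    ((lin (subι M _ hP) ∘ₗ ρ).codRestrict p.domain hρN)
  have hf : FixEquivariant A f := fun σ hσ y =>
    hp.2 σ _ _ (congrArg (lin (subι M _ hP)) (hρ σ hσ y))
  obtain ⟨g, hg, hgf⟩ := c.exists_equivariant A hf
  have hfp : ∀ (y : P) (hy : y ∈ N), f y = p ⟨y.1, hy⟩ := fun y hy =>
    congrArg p (Subtype.ext (congrArg (lin (subι M _ hP)) (hρid y hy)))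
  refine ⟨⟨p.domain ⊔ cyc x, g⟩, ⟨hP, fun σ y z hyz => ?_⟩, ⟨le_sup_left, fun y z hyz => ?_⟩, x'.2⟩
  · change g z = σ • g y
    rw [← hg σ (fix_empty σ) y]
    exact congrArg g (Subtype.ext hyz)
  · change p y = g z
    have hz : (z : M) ∈ p.domain := hyz ▸ y.2
    rw [hgf z fun τ => ?_, hfp z hz]
    · exact congrArg p (Subtype.ext hyz)
    · rw [hfp z hz, hfp (τ • (show P from z)) (hN τ (fix_empty τ) z hz)]
      exact hp.2 τ _ _ rfl

/-- An object with constant term operators is injective. -/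
theorem ConstTerms.injective {Q : SmoothSemilinRep k} (c : ConstTerms Q) : Injective Q where
  factors {X Y} g f _ := by
    have hf := lin_injective_of_mono f
    let e := LinearEquiv.ofInjective (lin f) hf
    let p₀ : Y →ₗ.[RatFun k] Q := ⟨LinearMap.range (lin f), lin g ∘ₗ e.symm.toLinearMap⟩
    have he : ∀ (x : X) (y : LinearMap.range (lin f)), (y : Y) = lin f x → e.symm y = x := by
      intro x y hy
      rw [LinearEquiv.symm_apply_eq]
      exact Subtype.ext hy
    have hp₀ : EquivariantPMap p₀ := by
      refine ⟨?_, ?_⟩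
      · rintro σ - _ ⟨x, rfl⟩
        exact ⟨σ • x, lin_smul f σ x⟩
      · rintro σ ⟨_, x, rfl⟩ y hy
        change lin g (e.symm y) = σ • lin g (e.symm ⟨lin f x, x, rfl⟩)
        rw [he x ⟨lin f x, x, rfl⟩ rfl, he (σ • x) y (hy.trans (lin_smul f σ x).symm), lin_smul]
    obtain ⟨p, hp₀p, hp⟩ := zorn_le_nonempty₀ {p : Y →ₗ.[RatFun k] Q | EquivariantPMap p}
      (fun s hs hchain q₀ hq₀ => ⟨LinearPMap.sSup s hchain.directedOn,
        equivariantPMap_sSup ⟨q₀, hq₀⟩ hchain hs, fun q hq => LinearPMap.le_sSup _ hq⟩) p₀ hp₀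
    have htop : ∀ y, y ∈ p.domain := by
      intro y
      obtain ⟨q, hq, hpq, hy⟩ := hp.prop.exists_extension c y
      exact (hp.le_of_ge hq hpq).1 hy
    refine ⟨ofLin (p.toFun ∘ₗ LinearMap.id.codRestrict p.domain htop) fun σ y =>
      hp.prop.2 σ _ _ rfl, hom_ext fun x => ?_⟩
    change p ⟨lin f x, _⟩ = lin g x
    have h1 := hp₀p.2 (x := ⟨lin f x, x, rfl⟩) (y := ⟨lin f x, htop _⟩) rfl
    rw [← h1]
    change lin g (e.symm ⟨lin f x, x, rfl⟩) = _
    rw [he x ⟨lin f x, x, rfl⟩ rfl]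

end SmoothSemilinRep
namespace SmoothSemilinRep

open SemilinRep

variable {k : Type u} [Field k]

/-! ### Endomorphisms of `𝐈^r` -/

theorem supportedBy_basisI {r : ℕ} (U : Set.powersetCard ℕ r) :
    SupportedBy (U : Finset ℕ) (basisI k r U) := fun σ hσ => by
  rw [smul_basisI]
  congr 1
  exact Subtype.ext (smul_finset_of_mem_fix hσ subset_rfl)

theorem exists_smul_powersetCard_eq {r : ℕ} (U V : Set.powersetCard ℕ r) :
    ∃ σ : infSymm, σ • U = V := by
  obtain ⟨σ, -, h⟩ := exists_smul_eq (A := ∅) (U.2.trans V.2.symm) (by simp) (by simp)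
  exact ⟨σ, Subtype.ext h⟩

theorem FixEquivariant.supportedBy_of_empty {M Q : SmoothSemilinRep k} {S : Finset ℕ}
    {f : M →ₗ[RatFun k] Q} (hf : FixEquivariant ∅ f) {x : M} (hx : SupportedBy S x) :
    SupportedBy S (f x) := by
  simpa using hf.supportedBy hx

theorem fixEquivariant_lin {M Q : SmoothSemilinRep k} (f : M ⟶ Q) (A : Finset ℕ) :
    FixEquivariant A (lin f) := fun σ _ x => lin_smul f σ x

/-- The image of `e_V` is supported by `V`, whose only `r`-element subset is `V`; so `f` is
diagonal. -/
theorem repr_endomorphism {r : ℕ} (f : I k r ⟶ I k r) (x : I k r) (U : Set.powersetCard ℕ r) :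
    (basisI k r).repr (lin f x) U =
      (basisI k r).repr x U * (basisI k r).repr (lin f (basisI k r U)) U := by
  have h : (basisI k r).coord U ∘ₗ lin f =
      (basisI k r).repr (lin f (basisI k r U)) U • (basisI k r).coord U := by
    refine (basisI k r).ext fun V => ?_
    simp only [LinearMap.comp_apply, LinearMap.smul_apply, Module.Basis.coord_apply,
      Module.Basis.repr_self, smul_eq_mul]
    by_cases hVU : V = U
    · simp [hVU]
    · rw [Finsupp.single_eq_of_ne (Ne.symm hVU), mul_zero]
      by_contra h0
      have h1 := SupportedBy.subset_of_repr_ne_zero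
        ((fixEquivariant_lin f ∅).supportedBy_of_empty (supportedBy_basisI V)) h0
      exact hVU (Subtype.ext (Finset.eq_of_subset_of_card_le h1
        (V.2.trans U.2.symm).le).symm)
  have := DFunLike.congr_fun h x
  simpa [mul_comm] using this

/-- The diagonal entries are conjugate under `𝔖`, so if one vanishes all do. -/
theorem lin_injective_of_ne_zero {r : ℕ} (f : I k r ⟶ I k r) (hf : f ≠ 0) :
    Function.Injective (lin f) := by
  have hc : ∀ U, (basisI k r).repr (lin f (basisI k r U)) U ≠ 0 := by
    intro U hU
    refine hf (hom_ext fun x => (basisI k r).ext_elem fun V => ?_)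
    rw [repr_endomorphism]
    obtain ⟨σ, rfl⟩ := exists_smul_powersetCard_eq U V
    rw [← smul_basisI, lin_smul, repr_smul, hU, smul_zero, mul_zero]
    simp
  rw [injective_iff_map_eq_zero]
  intro x hx
  refine (basisI k r).ext_elem fun U => ?_
  have h1 := repr_endomorphism f x U
  rw [hx, map_zero, Finsupp.zero_apply, eq_comm, mul_eq_zero] at h1
  simpa using h1.resolve_right (hc U)

instance (r : ℕ) : Injective (I k r) := (constTermsI k r).injective

/-- Two non-zero subobjects of `𝐈^r` have a non-zero intersection. -/
theorem disjoint_sub_I {r : ℕ} {A B : Submodule (RatFun k) (I k r)} (hA : Stable ∅ A)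
    (hB : Stable ∅ B) (h : Disjoint A B) (hA0 : A ≠ ⊥) : B = ⊥ := by
  let u : prod (sub _ A hA) (sub _ B hB) ⟶ I k r :=
    ofLin (M := prod (sub _ A hA) (sub _ B hB)) (LinearMap.coprod A.subtype B.subtype)
      fun σ x => (smul_add σ (lin (subι _ A hA) x.1) (lin (subι _ B hB) x.2)).symm
  have hu : Function.Injective (lin u) := by
    rw [injective_iff_map_eq_zero]
    rintro ⟨⟨a, ha'⟩, ⟨b, hb'⟩⟩ hab
    have hab' : a + b = 0 := hab
    have h1 : a = -b := eq_neg_of_add_eq_zero_left hab'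
    have ha : a = 0 := Submodule.disjoint_def.1 h _ ha' (h1 ▸ neg_mem hb')
    have hb : b = 0 := by rw [ha, zero_add] at hab'; exact hab'
    exact Prod.ext (Subtype.ext ha) (Subtype.ext hb)
  have := mono_of_lin_injective u hu
  let p : prod (sub _ A hA) (sub _ B hB) ⟶ I k r :=
    ofLin (M := prod (sub _ A hA) (sub _ B hB))
      (A.subtype ∘ₗ LinearMap.fst (RatFun k) A B) fun σ x => rfl
  -- An endomorphism of `𝐈^r` that is the identity on `A` and zero on `B`; being non-zero it is
  -- injective, which forces `B` to vanish.
  let φ := Injective.factorThru p u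
  have hφ : ∀ (a : A) (b : B), lin φ ((a : I k r) + b) = a := fun a b =>
    congrArg (fun g => lin g ((a, b) : A × B)) (Injective.comp_factorThru p u)
  obtain ⟨a, ha, ha0⟩ := Submodule.exists_mem_ne_zero_of_ne_bot hA0
  have hφ0 : φ ≠ 0 := by
    intro h0
    have h1 := hφ ⟨a, ha⟩ 0
    rw [h0] at h1
    exact ha0 h1.symm
  rw [eq_bot_iff]
  intro b hb
  refine lin_injective_of_ne_zero φ hφ0 ?_
  have h1 := hφ 0 ⟨b, hb⟩
  simpa using h1

/-! ### Subobjects that embed in some `𝐈^r` -/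

/-- The subspace spanned by the vectors with a support that does not contain `T`. -/
def low (T : Finset ℕ) (M : SmoothSemilinRep k) : Submodule (RatFun k) M :=
  Submodule.span (RatFun k) {x | ∃ S, SupportedBy S x ∧ ¬ T ⊆ S}

theorem FixEquivariant.map_low {M Q : SmoothSemilinRep k} {A T : Finset ℕ}
    {f : M →ₗ[RatFun k] Q} (hf : FixEquivariant A f) (hTA : Disjoint T A) :
    low T M ≤ (low T Q).comap f := by
  refine Submodule.span_le.2 ?_
  rintro x ⟨S, hx, hTS⟩
  refine Submodule.subset_span ⟨S ∪ A, hf.supportedBy hx, fun h => hTS ?_⟩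
  exact fun t ht => (Finset.mem_union.1 (h ht)).resolve_right (Finset.disjoint_left.1 hTA ht)

theorem repr_eq_zero_of_mem_low {r : ℕ} {T : Finset ℕ} {x : I k r} (hx : x ∈ low T (I k r))
    {U : Set.powersetCard ℕ r} (hU : T ⊆ (U : Finset ℕ)) : (basisI k r).repr x U = 0 := by
  have h : low T (I k r) ≤ LinearMap.ker ((basisI k r).coord U) := by
    refine Submodule.span_le.2 ?_
    rintro x ⟨S, hx, hTS⟩
    change (basisI k r).repr x U = 0
    by_contra h
    exact hTS (hU.trans (SupportedBy.subset_of_repr_ne_zero hx h))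
  exact h hx

/-- Conjugating a retraction by `σ` moves `A` to `σ • A`, which can be made disjoint from `T`;
stability of `N` keeps it a retraction. -/
theorem exists_retraction_disjoint {M : SmoothSemilinRep k} {N : Submodule (RatFun k) M}
    (hN : Stable ∅ N) (x : M) (h : N ⊔ cyc x = ⊤) (T : Finset ℕ) :
    ∃ (A : Finset ℕ) (ρ : M →ₗ[RatFun k] M), Disjoint T A ∧ FixEquivariant A ρ ∧
      (∀ y, ρ y ∈ N) ∧ ∀ y ∈ N, ρ y = y := by
  obtain ⟨A, ρ, hρ, hρN, hρid⟩ := exists_retraction hN x h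
  obtain ⟨σ, hσ⟩ := exists_smul_disjoint A T
  refine ⟨σ • A,
    { toFun := fun y => σ • ρ (σ⁻¹ • y)
      map_add' := fun y z => by simp
      map_smul' := fun a y => by
        rw [M.semilinear, ρ.map_smul, M.semilinear, smul_inv_smul, RingHom.id_apply] },
    hσ.symm, fun τ hτ y => ?_, fun y => hN σ (fix_empty σ) _ (hρN _), fun y hy => ?_⟩
  · have h1 := hρ _ (conj_mem_fix hτ) (σ⁻¹ • y)
    simp only [mul_smul, smul_inv_smul] at h1
    change σ • ρ (σ⁻¹ • τ • y) = τ • σ • ρ (σ⁻¹ • y)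
    rw [h1, smul_inv_smul]
  · change σ • ρ (σ⁻¹ • y) = y
    rw [hρid _ (hN _ (fix_empty _) y hy), smul_inv_smul]

/-- A retraction equivariant away from `T` carries `low T` of the object into `low T` of the
subobject. Hence the quotient by `low T` of the subobject embeds in that of the object. -/
theorem comap_low_le {M : SmoothSemilinRep k} {N : Submodule (RatFun k) M}
    (hN : Stable ∅ N) (x : M) (h : N ⊔ cyc x = ⊤) (T : Finset ℕ) :
    (low T M).comap (lin (subι M N hN)) ≤ low T (sub M N hN) := by
  obtain ⟨A, ρ, hTA, hρ, hρN, hρid⟩ := exists_retraction_disjoint hN x h T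
  let ρ' : M →ₗ[RatFun k] sub M N hN := ρ.codRestrict N hρN
  have hρ' : FixEquivariant A ρ' := fun σ hσ y => Subtype.ext (hρ σ hσ y)
  intro y hy
  have h1 := hρ'.map_low hTA hy
  have h2 : ρ' (lin (subι M N hN) y) = y := Subtype.ext (hρid _ y.2)
  rw [Submodule.mem_comap, h2] at h1
  exact h1

namespace Fam

variable {M : SmoothSemilinRep k} {G : Fam M}

theorem supportedBy_e (G : Fam M) {i : G.ι} {T : Finset ℕ} (hc : T.card = G.r i)
    (hT : Disjoint T G.base) : SupportedBy (G.base ∪ T) (G.e i T) := fun σ hσ => by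
  rw [G.smul_e i σ (fix_anti Finset.subset_union_left hσ) T hc hT,
    smul_finset_of_mem_fix hσ Finset.subset_union_right]

/-- Modulo `low T` only the vectors `e i U` with `T ⊆ U` survive; by size this means `U = T`, and
there are finitely many `i`. -/
theorem finite_quotient_low (hG : G.span = ⊤) {T : Finset ℕ} (hr : ∀ i, G.r i ≤ T.card)
    (hT : Disjoint T G.base) : Module.Finite (RatFun k) (M ⧸ low T M) := by
  let S : Submodule (RatFun k) M := Submodule.span (RatFun k) (Set.range fun i => G.e i T)
  have : Module.Finite (RatFun k) S := Module.Finite.span_of_finite _ (Set.finite_range _)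
  refine Module.Finite.of_surjective ((low T M).mkQ ∘ₗ S.subtype) ?_
  have h : low T M ⊔ S = ⊤ := by
    rw [eq_top_iff, ← hG]
    refine span_le fun i U hc hU => ?_
    by_cases hTU : T ⊆ U
    · obtain rfl := Finset.eq_of_subset_of_card_le hTU (hc.le.trans (hr i))
      exact Submodule.mem_sup_right (Submodule.subset_span ⟨i, rfl⟩)
    · refine Submodule.mem_sup_left
        (Submodule.subset_span ⟨_, G.supportedBy_e hc hU, fun h => hTU ?_⟩)
      exact fun t ht => (Finset.mem_union.1 (h ht)).resolve_left (Finset.disjoint_left.1 hT ht)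
  intro q
  obtain ⟨x, rfl⟩ := (low T M).mkQ_surjective q
  obtain ⟨l, hl, s, hs, rfl⟩ := Submodule.mem_sup.1
    (show x ∈ low T M ⊔ S from h ▸ Submodule.mem_top)
  refine ⟨⟨s, hs⟩, ?_⟩
  have : (low T M).mkQ l = 0 := by simpa using hl
  rw [map_add, this, zero_add]
  rfl

/-- The coordinates with respect to one of the families of vectors, as a map to `𝐈^r`. -/
theorem exists_fixEquivariant (hG : G.span = ⊤) (hli : LinearIndependent (RatFun k) G.vec)
    (i₀ : G.ι) : ∃ f : M →ₗ[RatFun k] I k (G.r i₀), FixEquivariant G.base f ∧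
      ∀ (U : Finset ℕ) (hc : U.card = G.r i₀), Disjoint U G.base →
        f (G.e i₀ U) = basisI k (G.r i₀) ⟨U, hc⟩ := by
  classical
  let b : Module.Basis G.Idx (RatFun k) M := Module.Basis.mk hli hG.ge
  let f : M →ₗ[RatFun k] I k (G.r i₀) := b.constr (RatFun k) fun p =>
    if h : p.1.1 = i₀ then basisI k (G.r i₀) ⟨p.1.2, h ▸ p.2.1⟩ else 0
  have hf : ∀ (i : G.ι) (U : Finset ℕ) (hc : U.card = G.r i), Disjoint U G.base →
      f (G.e i U) = if h : i = i₀ then basisI k (G.r i₀) ⟨U, h ▸ hc⟩ else 0 := by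
    intro i U hc hU
    have h1 := b.constr_basis (RatFun k) (fun p : G.Idx =>
      if h : p.1.1 = i₀ then basisI k (G.r i₀) ⟨p.1.2, h ▸ p.2.1⟩ else 0) ⟨(i, U), hc, hU⟩
    rwa [show b ⟨(i, U), hc, hU⟩ = G.e i U from Module.Basis.mk_apply _ _ _] at h1
  refine ⟨f, fun σ hσ x => ?_, fun U hc hU => (hf i₀ U hc hU).trans (dif_pos rfl)⟩
  · have hx : x ∈ G.span := hG ▸ Submodule.mem_top
    induction hx using Submodule.span_induction with
    | mem x hx =>
      obtain ⟨⟨⟨i, U⟩, hc, hU⟩, rfl⟩ := hx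
      change U.card = G.r i at hc
      change f (σ • G.e i U) = σ • f (G.e i U)
      rw [G.smul_e i σ hσ U hc hU, hf i U hc hU, hf i (σ • U) (by simpa using hc)
        (disjoint_smul hσ hU)]
      by_cases h : i = i₀
      · rw [dif_pos h, dif_pos h, smul_basisI]
        rfl
      · rw [dif_neg h, dif_neg h, smul_zero]
    | zero => simp
    | add x y _ _ hx hy => rw [smul_add, map_add, map_add, smul_add, hx, hy]
    | smul a x _ hx => rw [M.semilinear, f.map_smul, f.map_smul, (I k _).semilinear, hx]

/-- An object with a basis consisting of equivariant families has a non-zero morphism to `𝐈^r`,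
where `r` is the largest of the sizes. -/
theorem exists_hom_ne_zero (hG : G.span = ⊤) (hli : LinearIndependent (RatFun k) G.vec)
    (i₀ : G.ι) (hmax : ∀ i, G.r i ≤ G.r i₀) : ∃ φ : M ⟶ I k (G.r i₀), φ ≠ 0 := by
  obtain ⟨f, hf, hfe⟩ := exists_fixEquivariant hG hli i₀
  obtain ⟨T, hTc, hT⟩ : ∃ T : Finset ℕ, T.card = G.r i₀ ∧ Disjoint T G.base := by
    obtain ⟨σ, hσ⟩ := exists_smul_disjoint (Finset.range (G.r i₀)) G.base
    exact ⟨_, by simp, hσ⟩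
  let T' : Set.powersetCard ℕ (G.r i₀) := ⟨T, hTc⟩
  -- The vector `e i₀ T` has the right coordinate, but its support may meet the base. If no suitable
  -- `y` existed, then with `τ` moving the base away from itself and from `T`, the coordinate at `T`
  -- of `f (τ • x)` would vanish for all `x`: for a generator `e i U`, either `T = τ • U` and the
  -- support avoids the base, or the support of the value does not contain `T`.
  obtain ⟨y, S, hy, hSA, h0⟩ : ∃ (y : M) (S : Finset ℕ), SupportedBy S y ∧ Disjoint S G.base ∧
      (basisI k (G.r i₀)).repr (f y) T' ≠ 0 := by
    by_contra! hcon
    obtain ⟨τ, hτ⟩ := exists_smul_disjoint G.base (G.base ∪ T)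
    rw [Finset.disjoint_union_right] at hτ
    have h1 : ∀ x : M, (basisI k (G.r i₀)).repr (f (τ • x)) T' = 0 := by
      intro x
      have hx : x ∈ G.span := hG ▸ Submodule.mem_top
      induction hx using Submodule.span_induction with
      | mem x hx =>
        obtain ⟨⟨⟨i, U⟩, hc, hU⟩, rfl⟩ := hx
        change U.card = G.r i at hc
        have hs := (G.supportedBy_e hc hU).smul τ
        rw [Finset.smul_finset_union] at hs
        by_cases hTU : T ⊆ τ • U
        · have hTU' : T = τ • U := Finset.eq_of_subset_of_card_le hTU (by
            rw [Finset.card_smul_finset, hc, hTc]; exact hmax i)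
          refine hcon _ _ hs (Finset.disjoint_union_left.2 ⟨hτ.1, hTU' ▸ hT⟩)
        · by_contra h
          refine hTU fun t ht => ?_
          have h2 := SupportedBy.subset_of_repr_ne_zero (hf.supportedBy hs) h ht
          rw [Finset.mem_union, Finset.mem_union] at h2
          rcases h2 with (h2 | h2) | h2
          · exact absurd ht (Finset.disjoint_left.1 hτ.2 h2)
          · exact h2
          · exact absurd h2 (Finset.disjoint_left.1 hT ht)
      | zero => simp
      | add x y _ _ hx hy => rw [smul_add, map_add, map_add, Finsupp.add_apply, hx, hy, add_zero]
      | smul a x _ hx => rw [M.semilinear, f.map_smul, map_smul, Finsupp.smul_apply, hx, smul_zero]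
    have h2 := h1 (τ⁻¹ • G.e i₀ T)
    rw [smul_inv_smul, hfe T hTc hT, Module.Basis.repr_self, Finsupp.single_eq_same] at h2
    exact one_ne_zero h2
  obtain ⟨g, hg, hg0⟩ := exists_equivariant_ne_zero G.base hf hy hSA (T := T') hT h0
  exact ⟨hg.hom, fun h => hg0 (congrArg lin h)⟩

end Fam

theorem exists_fam_basis {M : SmoothSemilinRep k} {x : M} (hx : cyc x = ⊤) :
    ∃ G : Fam M, G.span = ⊤ ∧ LinearIndependent (RatFun k) G.vec := by
  obtain ⟨G, hG, hli⟩ := exists_linearIndependent_fam (M := M) (N := ⊥)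
    (fun σ _ y hy => by rw [Submodule.mem_bot] at hy ⊢; rw [hy, smul_zero]) x
  rw [bot_sup_eq, bot_sup_eq, hx] at hG
  exact ⟨G, hG, LinearIndependent.of_comp _ hli⟩

/-- The same `r`, the largest size in a basis of families, serves both for finiteness and for the
morphism; the minimality argument for subobjects relies on this. -/
theorem exists_finite_and_hom_ne_zero {M : SmoothSemilinRep k} {x : M} (hx : cyc x = ⊤)
    (hx0 : x ≠ 0) : ∃ r : ℕ, (∃ T : Finset ℕ, T.card = r ∧
      Module.Finite (RatFun k) (M ⧸ low T M)) ∧ ∃ φ : M ⟶ I k r, φ ≠ 0 := by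
  obtain ⟨G, hG, hli⟩ := exists_fam_basis hx
  have : Nonempty G.ι := by
    by_contra h
    rw [not_nonempty_iff] at h
    have : G.span ≤ ⊥ := Fam.span_le fun i => h.elim i
    rw [hG] at this
    exact hx0 ((Submodule.mem_bot _).1 (this Submodule.mem_top))
  obtain ⟨i₀, hmax⟩ := Finite.exists_max G.r
  obtain ⟨σ, hσ⟩ := exists_smul_disjoint (Finset.range (G.r i₀)) G.base
  exact ⟨G.r i₀, ⟨_, by simp, Fam.finite_quotient_low hG (by simpa using hmax) hσ⟩,
    Fam.exists_hom_ne_zero hG hli i₀ hmax⟩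

theorem cyc_sub_eq_top {M : SmoothSemilinRep k} (x : M) :
    cyc (M := sub M (cyc x) (stable_cyc x)) ⟨x, mem_cyc x⟩ = ⊤ := by
  rw [eq_top_iff]
  rintro ⟨y, hy⟩ -
  induction hy using Submodule.span_induction with
  | mem y hy =>
    obtain ⟨σ, rfl⟩ := hy
    exact stable_cyc (M := sub M (cyc x) (stable_cyc x)) ⟨x, mem_cyc x⟩ σ (fix_empty σ) _
      (mem_cyc _)
  | zero => exact zero_mem _
  | add y z _ _ hy hz => exact add_mem hy hz
  | smul a y _ hy => exact Submodule.smul_mem _ a hy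

/-- Every `r`-element set contains a translate of `T`. -/
theorem hom_eq_zero_of_repr {M : SmoothSemilinRep k} {r : ℕ} (φ : M ⟶ I k r) {T : Finset ℕ}
    (hT : T.card ≤ r)
    (h : ∀ (x : M) (U : Set.powersetCard ℕ r), T ⊆ (U : Finset ℕ) →
      (basisI k r).repr (lin φ x) U = 0) : φ = 0 := by
  refine hom_ext fun x => (basisI k r).ext_elem fun U => ?_
  obtain ⟨V, hVU, hV⟩ := Finset.exists_subset_card_eq (hT.trans U.2.ge)
  obtain ⟨σ, -, hσ⟩ := exists_smul_eq (A := ∅) hV (by simp) (by simp)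
  have h1 := h (σ • x) (σ • U) (hσ ▸ Finset.smul_finset_subset_smul_finset hVU)
  rw [lin_smul, repr_smul, smul_eq_zero_iff_eq] at h1
  simpa using h1

/-- Every non-zero object has a non-zero subobject that embeds in some `𝐈^r`. -/
theorem exists_subobject_of_I {M : SmoothSemilinRep k} {x₀ : M} (hx₀ : x₀ ≠ 0) :
    ∃ (P : SmoothSemilinRep k) (x : P) (ι : P ⟶ M) (r : ℕ) (φ : P ⟶ I k r), x ≠ 0 ∧
      Function.Injective (lin ι) ∧ Function.Injective (lin φ) := by
  classical
  let Adm : ℕ → ℕ → Prop := fun D n => ∃ (P : SmoothSemilinRep k) (x : P) (ι : P ⟶ M)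
    (T : Finset ℕ), x ≠ 0 ∧ cyc x = ⊤ ∧ Function.Injective (lin ι) ∧ T.card = D ∧
      Module.Finite (RatFun k) (P ⧸ low T P) ∧ Module.finrank (RatFun k) (P ⧸ low T P) = n
  have hne : ∃ D, ∃ n, Adm D n := by
    obtain ⟨r, ⟨T, hT, hfin⟩, -⟩ := exists_finite_and_hom_ne_zero (cyc_sub_eq_top x₀)
      fun h => hx₀ (congrArg Subtype.val h)
    exact ⟨r, _, _, _, subι M _ (stable_cyc x₀), T, fun h => hx₀ (congrArg Subtype.val h),
      cyc_sub_eq_top x₀, Subtype.val_injective, hT, hfin, rfl⟩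
  -- Among the non-zero cyclic subobjects of `M`, take one with the size `D` of `T` minimal, and
  -- then with the dimension of the quotient by `low T` minimal.
  obtain ⟨P, x, ι, T, hx0, hx, hι, hT, hfin, hn⟩ := Nat.find_spec (Nat.find_spec hne)
  obtain ⟨r, ⟨T', hT', hfin'⟩, φ, hφ⟩ := exists_finite_and_hom_ne_zero hx hx0
  have hr : T.card ≤ r := by
    rw [hT]
    exact Nat.find_min' hne ⟨_, P, x, ι, T', hx0, hx, hι, hT', hfin', rfl⟩
  refine ⟨P, x, ι, r, φ, hx0, hι, ?_⟩
  rw [injective_iff_map_eq_zero]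
  intro y hy
  by_contra hy0
  let j := subι P (cyc y) (stable_cyc y)
  let f : (sub P (cyc y) (stable_cyc y) ⧸ low T (sub P (cyc y) (stable_cyc y))) →ₗ[RatFun k]
      P ⧸ low T P :=
    Submodule.mapQ _ _ (lin j) ((fixEquivariant_lin j ∅).map_low (by simp))
  have hf : Function.Injective f := by
    rw [← LinearMap.ker_eq_bot, Submodule.ker_mapQ, ← le_bot_iff, Submodule.map_le_iff_le_comap]
    refine (comap_low_le (stable_cyc y) x (by rw [hx, sup_top_eq]) T).trans ?_
    intro z hz
    simpa using hz
  have hfin2 : Module.Finite (RatFun k)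
      (sub P (cyc y) (stable_cyc y) ⧸ low T (sub P (cyc y) (stable_cyc y))) :=
    Module.Finite.of_injective f hf
  have h1 : Module.finrank (RatFun k) (P ⧸ low T P) ≤ Module.finrank (RatFun k)
      (sub P (cyc y) (stable_cyc y) ⧸ low T (sub P (cyc y) (stable_cyc y))) := by
    rw [hn]
    refine Nat.find_min' (Nat.find_spec hne) ⟨_, _, j ≫ ι, T,
      fun h => hy0 (congrArg Subtype.val h), cyc_sub_eq_top y,
      hι.comp Subtype.val_injective, hT, hfin2, rfl⟩
  -- By minimality of the dimension, `P` is the sum of `cyc y` and `low T P`. As `φ` kills `cyc y`,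
  -- its image lies in `low T` of `𝐈^r`, where coordinates at sets containing `T` vanish; since `T`
  -- has at most `r` letters, `φ = 0`.
  have hsurj := (LinearMap.injective_iff_surjective_of_finrank_eq_finrank
    (le_antisymm (LinearMap.finrank_le_finrank_of_injective hf) h1)).1 hf
  have hcyc : cyc y ≤ LinearMap.ker (lin φ) := cyc_le (stable_ker φ) hy
  refine hφ (hom_eq_zero_of_repr φ hr fun p U hU => ?_)
  obtain ⟨q, hq⟩ := hsurj ((low T P).mkQ p)
  obtain ⟨z, rfl⟩ := Submodule.mkQ_surjective _ q
  have h2 : p - lin j z ∈ low T P := by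
    rw [← Submodule.Quotient.mk_eq_zero, Submodule.Quotient.mk_sub, sub_eq_zero]
    exact hq.symm
  have h3 := (fixEquivariant_lin φ ∅).map_low (by simp) h2
  have h4 : lin φ (lin j z) = 0 := hcyc z.2
  rw [Submodule.mem_comap, map_sub, h4, sub_zero] at h3
  exact repr_eq_zero_of_mem_low h3 hU

end SmoothSemilinRep
namespace SmoothSemilinRep

open SemilinRep

variable {k : Type u} [Field k]

/-! ### Maps to and from direct sums -/

section DirectSum

variable {ι : Type u} {M : ι → SmoothSemilinRep k}

/-- The morphism from a direct sum given by morphisms from the summands. -/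
def dsDesc {N : SmoothSemilinRep k} (f : ∀ i, M i ⟶ N) : directSum M ⟶ N := by
  classical
  refine ofLin (M := directSum M) (DFinsupp.lsum ℕ fun i => lin (f i)) fun σ x => ?_
  have h : (DFinsupp.lsum ℕ fun i => lin (f i)).toAddMonoidHom.comp
      (DistribSMul.toAddMonoidHom (Π₀ i, M i) σ) =
      (DistribSMul.toAddMonoidHom N σ).comp
        (DFinsupp.lsum ℕ fun i => lin (f i)).toAddMonoidHom := by
    refine DFinsupp.addHom_ext fun i y => ?_
    change (DFinsupp.lsum ℕ fun i => lin (f i)) (σ • DFinsupp.single i y) =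
      σ • (DFinsupp.lsum ℕ fun i => lin (f i)) (DFinsupp.single i y)
    rw [← DFinsupp.single_smul, DFinsupp.lsum_single, DFinsupp.lsum_single, lin_smul]
  exact DFunLike.congr_fun h x

theorem lin_dsDesc [DecidableEq ι] {N : SmoothSemilinRep k} (f : ∀ i, M i ⟶ N) :
    lin (dsDesc f) = DFinsupp.lsum ℕ fun i => lin (f i) := by
  obtain rfl : ‹DecidableEq ι› = fun a b => Classical.propDecidable (a = b) :=
    Subsingleton.elim _ _
  rfl

variable (M) in
/-- The projection of a direct sum to a summand. -/
def dsProj (i : ι) : directSum M ⟶ M i :=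
  ofLin (M := directSum M) (DFinsupp.lapply i) fun _ _ => rfl

variable (M) in
theorem exists_dsProj_retraction (i : ι) : ∃ j : M i ⟶ directSum M, j ≫ dsProj M i = 𝟙 _ := by
  classical
  refine ⟨ofLin (N := directSum M)
    (DFinsupp.lsingle (R := RatFun k) (M := fun i => (M i).carrier) i) fun σ x => ?_, ?_⟩
  · change (DFinsupp.single i (σ • x) : Π₀ i, M i) = σ • (DFinsupp.single i x : Π₀ i, M i)
    rw [DFinsupp.single_smul]
  · ext x
    exact DFinsupp.single_eq_same (β := fun i => M i) (i := i) (b := x)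

theorem range_dsDesc {N : SmoothSemilinRep k} (f : ∀ i, M i ⟶ N) :
    LinearMap.range (lin (dsDesc f)) = ⨆ i, LinearMap.range (lin (f i)) := by
  classical
  rw [lin_dsDesc]
  refine le_antisymm ?_ (iSup_le fun i => ?_)
  · rintro _ ⟨x, rfl⟩
    refine DFinsupp.induction (p := fun x : Π₀ i, M i =>
      (DFinsupp.lsum ℕ fun i => lin (f i)) x ∈ ⨆ i, LinearMap.range (lin (f i))) x ?_ ?_
    · rw [map_zero]
      exact zero_mem _
    · intro i y x _ _ hx
      rw [map_add, DFinsupp.lsum_single]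
      exact add_mem (Submodule.mem_iSup_of_mem i ⟨y, rfl⟩) hx
  · rintro _ ⟨x, rfl⟩
    exact ⟨DFinsupp.single i x, DFinsupp.lsum_single _ _ _ _⟩

theorem dsDesc_injective {N : SmoothSemilinRep k} {f : ∀ i, M i ⟶ N}
    (hf : ∀ i, Function.Injective (lin (f i)))
    (h : iSupIndep fun i => LinearMap.range (lin (f i))) :
    Function.Injective (lin (dsDesc f)) := by
  classical
  rw [lin_dsDesc]
  have h1 : (DFinsupp.lsum ℕ fun i => lin (f i) : (Π₀ i, M i) →ₗ[RatFun k] N) =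
      (DFinsupp.lsum ℕ fun i => (LinearMap.range (lin (f i))).subtype) ∘ₗ
        DFinsupp.mapRange.linearMap fun i => (lin (f i)).rangeRestrict :=
    DFinsupp.lhom_ext fun i x => by
      rw [LinearMap.comp_apply, DFinsupp.mapRange.linearMap_apply, DFinsupp.mapRange_single,
        DFinsupp.lsum_single, DFinsupp.lsum_single]
      rfl
  rw [h1]
  refine h.dfinsupp_lsum_injective.comp ?_
  refine (DFinsupp.mapRange_injective _ fun i => map_zero _).2 fun i x y hxy => ?_
  exact hf i (congrArg Subtype.val hxy)

end DirectSum

instance {ι : Type u} (r : ι → ℕ) : Injective (directSum fun i => I k (r i)) :=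
  (ConstTerms.directSum fun i => constTermsI k (r i)).injective

/-! ### Splittings -/

theorem lin_apply_of_comp_eq_id {A X : SmoothSemilinRep k} {j : A ⟶ X} {p : X ⟶ A}
    (h : j ≫ p = 𝟙 A) (a : A) : lin p (lin j a) = a :=
  congrArg (fun g : A ⟶ A => lin g a) h

theorem nonempty_iso_of_retraction {A X : SmoothSemilinRep k} {j : A ⟶ X} {p : X ⟶ A}
    (h : j ≫ p = 𝟙 A) (hp : LinearMap.ker (lin p) = ⊥) : Nonempty (X ≅ A) :=
  ⟨p, j, hom_ext fun _ => LinearMap.ker_eq_bot.1 hp (lin_apply_of_comp_eq_id h _), h⟩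

theorem nonempty_iso_biprod {A X : SmoothSemilinRep k} {j : A ⟶ X} {p : X ⟶ A}
    (h : j ≫ p = 𝟙 A) :
    Nonempty (X ≅ A ⊞ sub X (LinearMap.ker (lin p)) (stable_ker p)) := by
  have hj := lin_apply_of_comp_eq_id h
  have hmem : ∀ x : X, (LinearMap.id - lin j ∘ₗ lin p : X →ₗ[RatFun k] X) x ∈
      LinearMap.ker (lin p) := fun x => by
    simp [hj]
  let b : Limits.BinaryBicone A (sub X (LinearMap.ker (lin p)) (stable_ker p)) :=
    { pt := X
      fst := p
      snd := ofLin (N := sub X _ (stable_ker p))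
        ((LinearMap.id - lin j ∘ₗ lin p).codRestrict _ hmem) fun σ x => Subtype.ext <| by
          change σ • x - lin j (lin p (σ • x)) = σ • (x - lin j (lin p x))
          rw [lin_smul, lin_smul, smul_sub]
      inl := j
      inr := subι X _ (stable_ker p)
      inl_fst := h
      inl_snd := hom_ext fun a => Subtype.ext <| by
        change lin j a - lin j (lin p (lin j a)) = 0
        rw [hj, sub_self]
      inr_fst := hom_ext fun x => x.2
      inr_snd := hom_ext fun x => Subtype.ext <| by
        change x.1 - lin j (lin p x.1) = x.1
        rw [show lin p x.1 = 0 from x.2, map_zero, sub_zero] }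
  have hb : b.IsBilimit := Limits.isBinaryBilimitOfTotal b <| hom_ext fun x => by
    change lin j (lin p x) + (x - lin j (lin p x)) = x
    abel
  exact ⟨Limits.biprod.uniqueUpToIso _ _ hb⟩

theorem eq_zero_of_isZero {M : SmoothSemilinRep k} (h : Limits.IsZero M) (x : M) : x = 0 :=
  congrArg (fun g : M ⟶ M => lin g x) ((Limits.IsZero.iff_id_eq_zero M).1 h)

/-! ### Injective objects are standard -/

theorem sSupIndep_insert {α : Type*} [CompleteLattice α] [IsModularLattice α] {s : Set α} {a : α}
    (hs : sSupIndep s) (ha : Disjoint a (sSup s)) : sSupIndep (insert a s) := by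
  rintro b hb
  by_cases hba : b = a
  · subst hba
    exact ha.mono_right (sSup_le_sSup (by simp))
  · have hbs : b ∈ s := hb.resolve_left hba
    have h1 : sSup (insert a s \ {b}) = sSup (s \ {b}) ⊔ a := by
      rw [Set.insert_sdiff_of_notMem _ (fun h => hba (Set.mem_singleton_iff.1 h).symm), sSup_insert,
        sup_comm]
    rw [h1]
    refine (hs hbs).disjoint_sup_right_of_disjoint_sup_left (ha.symm.mono_left ?_)
    exact sup_le (le_sSup hbs) (sSup_le_sSup Set.sdiff_subset)

variable (M : SmoothSemilinRep k) in
/-- The submodules that are the image of an embedding of some `𝐈^r`. -/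
def imagesI : Set (Submodule (RatFun k) M) :=
  {N | ∃ (r : ℕ) (j : I k r ⟶ M), Function.Injective (lin j) ∧ LinearMap.range (lin j) = N}

theorem exists_maximal_sSupIndep (M : SmoothSemilinRep k) :
    ∃ s, Maximal (fun s : Set (Submodule (RatFun k) M) => s ⊆ imagesI M ∧ sSupIndep s) s :=
  zorn_subset {s : Set (Submodule (RatFun k) M) | s ⊆ imagesI M ∧ sSupIndep s} fun c hc hchain =>
    ⟨⋃₀ c, ⟨Set.sUnion_subset fun _ hs => (hc hs).1,
      iSupIndep_sUnion_of_directed hchain.directedOn fun _ hs => (hc hs).2⟩,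
      fun _ hs => Set.subset_sUnion_of_mem hs⟩

/-- A non-zero direct summand of an injective object contains a copy of some `𝐈^r`. -/
theorem exists_embedding_comp_eq_zero {M Q : SmoothSemilinRep k} [Injective M] {ψ : Q ⟶ M}
    {ρ : M ⟶ Q} (h : ψ ≫ ρ = 𝟙 Q) (hρ : LinearMap.ker (lin ρ) ≠ ⊥) :
    ∃ (r : ℕ) (g : I k r ⟶ M), Function.Injective (lin g) ∧ g ≫ ρ = 0 ∧ g ≠ 0 := by
  obtain ⟨x₀, hx₀, hx₀0⟩ := Submodule.exists_mem_ne_zero_of_ne_bot hρ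
  obtain ⟨P, x, i, r, φ, hx, hi, hφ⟩ := exists_subobject_of_I
    (M := sub M _ (stable_ker ρ)) (x₀ := ⟨x₀, hx₀⟩) fun h => hx₀0 (congrArg Subtype.val h)
  have := mono_of_lin_injective φ hφ
  let g₀ : I k r ⟶ M := Injective.factorThru (i ≫ subι M _ (stable_ker ρ)) φ
  have hg₀ : ∀ y, lin g₀ (lin φ y) = lin (i ≫ subι M _ (stable_ker ρ)) y := fun y =>
    congrArg (fun g => lin g y)
      (Injective.comp_factorThru (i ≫ subι M _ (stable_ker ρ)) φ)
  -- This correction pushes the extension into the kernel of `ρ` without changing it on `P`. It is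
  -- injective because its kernel meets the non-zero image of `P` in `𝐈^r` trivially.
  let g : I k r ⟶ M := g₀ - (g₀ ≫ ρ) ≫ ψ
  have hg : ∀ y, lin g y = lin g₀ y - lin ψ (lin ρ (lin g₀ y)) := fun _ => rfl
  have hgφ : ∀ y, lin g (lin φ y) = (lin i y).1 := fun y => by
    rw [hg, hg₀]
    change (lin i y).1 - lin ψ (lin ρ (lin i y).1) = _
    rw [show lin ρ (lin i y).1 = 0 from (lin i y).2, map_zero, sub_zero]
  have hinj : ∀ y, lin g (lin φ y) = 0 → y = 0 := fun y hy => by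
    rw [hgφ] at hy
    exact hi ((Subtype.ext hy).trans (map_zero (lin i)).symm)
  have hstab : Stable ∅ (LinearMap.range (lin φ)) := by
    rintro σ - _ ⟨y, rfl⟩
    exact ⟨σ • y, lin_smul φ σ y⟩
  refine ⟨r, g, LinearMap.ker_eq_bot.1 (disjoint_sub_I hstab (stable_ker g) ?_ ?_), ?_, ?_⟩
  · rw [Submodule.disjoint_def]
    rintro _ ⟨y, rfl⟩ hy
    rw [hinj y hy, map_zero]
  · intro h0
    refine hx (hφ ?_)
    rw [map_zero]
    exact (Submodule.mem_bot _).1 (h0 ▸ LinearMap.mem_range_self _ x)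
  · refine hom_ext fun y => ?_
    change lin ρ (lin g y) = 0
    rw [hg, map_sub, lin_apply_of_comp_eq_id h, sub_self]
  · intro h0
    exact hx (hinj x (by rw [h0]; rfl))

/-- The sum of a maximal independent set of copies of various `𝐈^r` is injective, hence a direct
summand; a non-zero complement would contain a further copy, against maximality. -/
theorem isStandard_of_injective (M : SmoothSemilinRep k) [Injective M] : M.IsStandard := by
  obtain ⟨s, ⟨hs, hind⟩, hmax⟩ := exists_maximal_sSupIndep M
  choose r j hj hrange using fun N : s => hs N.2
  let ψ : directSum (fun N : s => I k (r N)) ⟶ M := dsDesc j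
  have hψ : Function.Injective (lin ψ) := dsDesc_injective hj (by
    simp_rw [hrange]
    exact (sSupIndep_iff s).1 hind)
  have hψr : LinearMap.range (lin ψ) = sSup s := by
    rw [range_dsDesc, sSup_eq_iSup']
    simp_rw [hrange]
  have := mono_of_lin_injective ψ hψ
  let ρ : M ⟶ directSum (fun N : s => I k (r N)) := Injective.factorThru (𝟙 _) ψ
  have h : ψ ≫ ρ = 𝟙 _ := Injective.comp_factorThru _ _
  refine ⟨s, r, nonempty_iso_of_retraction h ?_⟩
  by_contra hρ
  obtain ⟨t, g, hg, hgρ, hg0⟩ := exists_embedding_comp_eq_zero h hρ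
  have hdisj : Disjoint (LinearMap.range (lin g)) (sSup s) := by
    rw [← hψr, Submodule.disjoint_def]
    rintro _ ⟨y, rfl⟩ ⟨q, hq⟩
    have h1 : lin ρ (lin g y) = 0 := congrArg (fun f => lin f y) hgρ
    rw [← hq, lin_apply_of_comp_eq_id h] at h1
    rw [← hq, h1, map_zero]
  have hmem : LinearMap.range (lin g) ∈ s :=
    hmax ⟨Set.insert_subset ⟨t, g, hg, rfl⟩ hs, sSupIndep_insert hind hdisj⟩
      (Set.subset_insert _ s) (Set.mem_insert _ s)
  have h0 : LinearMap.range (lin g) = ⊥ := disjoint_self.1 (hdisj.mono_right (le_sSup hmem))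
  exact hg0 (hom_ext fun y => (Submodule.mem_bot _).1 (h0 ▸ LinearMap.mem_range_self _ y))

/-! ### Indecomposable objects -/

theorem not_isZero_I (r : ℕ) : ¬ Limits.IsZero (I k r) := by
  intro h
  let S : Set.powersetCard ℕ r := ⟨Finset.range r, by simp⟩
  exact (basisI k r).ne_zero S (eq_zero_of_isZero h _)

/-- A decomposition gives two idempotent endomorphisms with product zero. If one is non-zero it is
injective, and cancelling it shows that the other is zero. -/
theorem indecomposable_I (r : ℕ) : Indecomposable (I k r) := by
  refine ⟨not_isZero_I r, fun Y Z e => ?_⟩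
  by_cases hf : e.hom ≫ Limits.biprod.fst ≫ Limits.biprod.inl ≫ e.inv = 0
  · left
    rw [Limits.IsZero.iff_id_eq_zero]
    have h := congrArg (fun f => Limits.biprod.inl ≫ e.inv ≫ f ≫ e.hom ≫ Limits.biprod.fst) hf
    simpa using h
  · right
    have := mono_of_lin_injective _ (lin_injective_of_ne_zero _ hf)
    have hg : e.hom ≫ Limits.biprod.snd ≫ Limits.biprod.inr ≫ e.inv = 0 := by
      rw [← cancel_mono (e.hom ≫ Limits.biprod.fst ≫ Limits.biprod.inl ≫ e.inv)]
      simp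
    rw [Limits.IsZero.iff_id_eq_zero]
    have h := congrArg (fun f => Limits.biprod.inr ≫ e.inv ≫ f ≫ e.hom ≫ Limits.biprod.snd) hg
    simpa using h

theorem Indecomposable.of_iso {C : Type*} [Category* C] [Limits.HasZeroMorphisms C]
    [Limits.HasBinaryBiproducts C] {X Y : C} (e : X ≅ Y) (h : Indecomposable Y) :
    Indecomposable X :=
  ⟨fun h0 => h.1 (h0.of_iso e.symm), fun A B f => h.2 A B (e.symm ≪≫ f)⟩

/-- A non-zero direct sum has at least one summand `𝐈^r`; it splits off and is non-zero, so its
complement vanishes. -/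
theorem IsStandard.exists_iso_I {M : SmoothSemilinRep k} (h : M.IsStandard)
    (hM : Indecomposable M) : ∃ r : ℕ, Nonempty (M ≅ I k r) := by
  obtain ⟨ι, r, ⟨e⟩⟩ := h
  have hD := Indecomposable.of_iso e.symm hM
  obtain ⟨i⟩ : Nonempty ι := by
    by_contra hι
    rw [not_nonempty_iff] at hι
    refine hD.1 ((Limits.IsZero.iff_id_eq_zero _).2 (hom_ext fun x => ?_))
    exact DFinsupp.ext fun i => hι.elim i
  obtain ⟨j, hj⟩ := exists_dsProj_retraction (fun i => I k (r i)) i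
  obtain ⟨f⟩ := nonempty_iso_biprod hj
  have h0 := (hD.2 _ _ f).resolve_left (not_isZero_I _)
  obtain ⟨g⟩ := nonempty_iso_of_retraction hj (by
    rw [eq_bot_iff]
    exact fun x hx => congrArg Subtype.val (eq_zero_of_isZero h0 ⟨x, hx⟩))
  exact ⟨r i, ⟨e ≪≫ g⟩⟩

end SmoothSemilinRep

end

theorem corollary3p6 (k : Type u) [Field k] :
    (∀ M : SmoothSemilinRep k, CategoryTheory.Injective M → M.IsStandard) ∧
    (∀ M : SmoothSemilinRep k,
      (CategoryTheory.Injective M ∧ CategoryTheory.Indecomposable M) ↔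
        ∃ r : ℕ, Nonempty (M ≅ SmoothSemilinRep.I k r)) := by
  refine ⟨fun M _ => SmoothSemilinRep.isStandard_of_injective M, fun M => ⟨?_, ?_⟩⟩
  · rintro ⟨_, h⟩
    exact (SmoothSemilinRep.isStandard_of_injective M).exists_iso_I h
  · rintro ⟨r, ⟨e⟩⟩
    exact ⟨Injective.of_iso e.symm inferInstance,
      SmoothSemilinRep.Indecomposable.of_iso e (SmoothSemilinRep.indecomposable_I r)⟩
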